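/- Let $u,u',v,v'\in\mathbb C$ be such that $(u+k)(u'+k)>0$ and $(v+k)(v'+k)>0$ for all $k\in\mathbb Z$, and $u+u'+v+v'>-1$ (the sum is automatically real). Let $\mathcal D$ be the $\mathbb Z\times\mathbb Z$ matrix with $\mathcal D(x,x+1)=(x-u)(x-u')$, $\mathcal D(x,x-1)=(x+v)(x+v')$, $\mathcal D(x,x)=-(x-u)(x-u')-(x+v)(x+v')$, and all other entries $0$. For $N\ge1$ let $\mathbb{GT}_N$ be the (discrete) set of signatures $\lambda=(\lambda_1\ge\dots\ge\lambda_N)\in\mathbb Z^N$, and put $$\dim_N\lambda=\frac{\prod_{1\le i<j\le N}(\lambda_i-i-\lambda_j+j)}{\prod_{i=1}^{N-1}i!},\qquad d_N=\frac{N(N-1)(N-2)}3-(u+u'+v+v')\frac{N(N-1)}2 .$$ With $l_j=\lambda_j+N-j$ and $n_j=\nu_j+N-j$, define for $\lambda,\nu\in\mathbb{GT}_N$ $$\mathcal D^{(N)}(\lambda,\nu)=\frac{\dim_N\nu}{\dim_N\lambda}\sum_{i=1}^N\mathcal D(l_i,n_i)\,\mathbf 1_{\{l_j=n_j\ \forall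 j\ne i\}}-d_N\mathbf 1_{\lambda=\nu}.$$ A matrix $Q$ on a countable set $E$ is a matrix of transition rates if $Q(a,b)\ge0$ for $a\neq b$ and $\sum_{b\ne a}Q(a,b)=-Q(a,a)$ for every $a\in E$. Its minimal solution is $\overline P(t)=\sum_{n\ge0}P^{[n]}(t)$, $t\ge0$, where $P^{[0]}(t;a,b)=\mathbf 1_{a=b}e^{tQ(a,a)}$ and $$P^{[n]}(t;a,b)=\int_0^te^{\tau Q(a,a)}\sum_{c\ne a}Q(a,c)\,P^{[n-1]}(t-\tau;c,b)\,d\tau,\qquad n\ge1 .$$ One calls $Q$ regular if $\sum_b\overline P(t;a,b)=1$ for all $t\ge0$ and $a\in E$; the semigroup of $Q$ is then $(\overline P(t))_{t\ge0}$. Denote by $(P_1(t))_{t\ge0}$ and $(P_N(t))_{t\ge0}$ the families $\overline P$ for $Q=\mathcal D$ on $\mathbb Z$ and for $Q=\mathcal D^{(N)}$ on $\mathbb{GT}_N$. (For $N=1$, $\mathbb{GT}_1=\mathbb Z$ and $\mathcal D^{(1)}=\mathcal D$, so the notation is consistent.) **Theorem 3.7.** For every $N\ge1$, $\mathcal D^{(N)}$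 is a regular matrix of transition rates; for all $t\ge0$ and $\lambda,\nu\in\mathbb{GT}_N$, $$P_N(t;\lambda,\nu)=e^{-d_Nt}\,\frac{\dim_N\nu}{\dim_N\lambda}\,\det\bigl[P_1(t;\lambda_i+N-i,\nu_j+N-j)\bigr]_{i,j=1}^N ;$$ and $(P_N(t))_{t\ge0}$ is a Feller Markov semigroup. That is, the matrices $P_N(t)$ are stochastic, $P_N(0)=\mathrm{Id}$, $P_N(s)P_N(t)=P_N(s+t)$ for $s,t\ge0$, the operators $(P_N(t)f)(\lambda)=\sum_\nu P_N(t;\lambda,\nu)f(\nu)$ map $C_0(\mathbb{GT}_N)$ (functions tending to $0$ at infinity, with the supremum norm) to itself, and $t\mapsto P_N(t)f\in C_0(\mathbb{GT}_N)$ is continuous on $[0,\infty)$ for every $f\in C_0(\mathbb{GT}_N)$. -/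

import Mathlib

open scoped ENNReal ZeroAtInfty Nat

noncomputable section

namespace GTChain

/- ### Continuous-time Markov chains on a countable set -/

section Chains

variable {E : Type*}

/-- `Q` is a matrix of transition rates: the off-diagonal entries are nonnegative and
in each row they sum up to minus the diagonal entry. -/
structure IsRateMatrix (Q : E → E → ℝ) : Prop where
  offDiag_nonneg : ∀ a b, a ≠ b → 0 ≤ Q a b
  row_sum : ∀ a, HasSum (fun b : {b : E // b ≠ a} => Q a b) (-Q a a)

open Classical in
/-- The matrices `P^{[n]}(t)`, the probabilities to go from `a` to `b` in time `t` with exactly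
`n` jumps. With `-q` the diagonal part and `Q~` the off-diagonal part of `Q`:
`P^{[0]}(t) = exp (-t q)` and
`P^{[n+1]}(t) = ∫_0^t exp (-τ q) Q~ P^{[n]}(t - τ) dτ`.
All quantities are nonnegative, so that sums and integrals are taken in `[0, ∞]`. -/
def jumpTerm (Q : E → E → ℝ) : ℕ → ℝ → E → E → ℝ≥0∞
  | 0, t, a, b => if a = b then ENNReal.ofReal (Real.exp (t * Q a a)) else 0
  | n + 1, t, a, b =>
      ∫⁻ τ in Set.Ioc 0 t, ENNReal.ofReal (Real.exp (τ * Q a a)) *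
        ∑' c : E, (if c = a then 0 else ENNReal.ofReal (Q a c)) * jumpTerm Q n (t - τ) c b

/-- The minimal solution `∑ₙ P^{[n]}(t)` of the Kolmogorov equations with rates `Q`. -/
def minimalSolution (Q : E → E → ℝ) (t : ℝ) (a b : E) : ℝ≥0∞ :=
  ∑' n : ℕ, jumpTerm Q n t a b

/-- A matrix of transition rates is regular if its minimal solution is stochastic. -/
structure IsRegularRateMatrix (Q : E → E → ℝ) : Prop where
  isRateMatrix : IsRateMatrix Q
  stochastic : ∀ t : ℝ, 0 ≤ t → ∀ a, ∑' b : E, minimalSolution Q t a b = 1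

/-- The real matrices of the minimal solution. For regular `Q` (whose minimal
solution has entries at most `1`) this is the Markov semigroup with transition rates `Q`. -/
def semigroup (Q : E → E → ℝ) (t : ℝ) (a b : E) : ℝ :=
  (minimalSolution Q t a b).toReal

open Classical in
/-- `(P t)_{t ≥ 0}` is a Markov semigroup on the countable set `E`, given by its matrices. -/
structure IsMarkovSemigroup (P : ℝ → E → E → ℝ) : Prop where
  nonneg : ∀ t, 0 ≤ t → ∀ a b, 0 ≤ P t a b
  stochastic : ∀ t, 0 ≤ t → ∀ a, HasSum (fun b => P t a b) 1
  zero : ∀ a b, P 0 a b = if a = b then 1 else 0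
  chapman_kolmogorov : ∀ s t, 0 ≤ s → 0 ≤ t → ∀ a b,
    HasSum (fun c => P s a c * P t c b) (P (s + t) a b)

/-- A Markov semigroup on a countable discrete space `E` is Feller if the operators
`(P t f) a = ∑ b, P t a b * f b` map `C₀(E)` to itself and form a strongly continuous family
`t ↦ P t f` from `[0, ∞)` to `C₀(E)` with the supremum norm. -/
structure IsFellerSemigroup [TopologicalSpace E] [DiscreteTopology E] [Countable E]
    (P : ℝ → E → E → ℝ) : Prop where
  isMarkovSemigroup : IsMarkovSemigroup P
  feller : ∃ T : ℝ → C₀(E, ℝ) → C₀(E, ℝ),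
    (∀ t, 0 ≤ t → ∀ f a, HasSum (fun b => P t a b * f b) (T t f a)) ∧
    ∀ f, ContinuousOn (fun t => T t f) (Set.Ici 0)

end Chains

/- ### The bilateral birth and death process and the chain on signatures -/

/-- The conditions on the parameters. The last one is about `u + u' + v + v'`, which is real
by the first two conditions. -/
structure Admissible (u u' v v' : ℂ) : Prop where
  pos_u : ∀ k : ℤ, ∃ r : ℝ, 0 < r ∧ (u + k) * (u' + k) = r
  pos_v : ∀ k : ℤ, ∃ r : ℝ, 0 < r ∧ (v + k) * (v' + k) = r
  sum_gt : -1 < (u + u' + v + v').re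

/-- The rate `(x - u)(x - u')` of the jump `x → x + 1` (a real number for admissible
parameters). -/
def birthRate (u u' : ℂ) (x : ℤ) : ℝ := (((x : ℂ) - u) * ((x : ℂ) - u')).re

/-- The rate `(x + v)(x + v')` of the jump `x → x - 1` (a real number for admissible
parameters). -/
def deathRate (v v' : ℂ) (x : ℤ) : ℝ := (((x : ℂ) + v) * ((x : ℂ) + v')).re

/-- The matrix of transition rates of the bilateral birth and death process on `ℤ`. -/
def rateOne (u u' v v' : ℂ) (x y : ℤ) : ℝ :=
  if y = x + 1 then birthRate u u' x
  else if y = x - 1 then deathRate v v' x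
  else if y = x then -birthRate u u' x - deathRate v v' x
  else 0

/-- Signatures of length `N`: weakly decreasing `N`-tuples of integers. As a subspace
of `ℤ^N` this set carries the discrete topology. -/
abbrev Signature (N : ℕ) : Type := {l : Fin N → ℤ // Antitone l}

/-- The strictly decreasing coordinates `λ_i + N - i`, `1 ≤ i ≤ N` (the index in `Fin N`
is `i - 1`). -/
def coord {N : ℕ} (lam : Signature N) (i : Fin N) : ℤ :=
  lam.1 i + (N : ℤ) - ((i : ℤ) + 1)

/-- The dimension of the irreducible representation of `U(N)` with highest weight `λ`, by
Weyl's formula `∏_{i<j} (λ_i - i - λ_j + j) / ∏_{i=1}^{N-1} i!`. -/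
def dim {N : ℕ} (lam : Signature N) : ℝ :=
  (∏ i : Fin N, ∏ j ∈ Finset.Ioi i,
      ((lam.1 i : ℝ) - ((i : ℕ) : ℝ) - (lam.1 j : ℝ) + ((j : ℕ) : ℝ))) /
    ∏ i ∈ Finset.range N, (i ! : ℝ)

/-- The constant `d_N = N(N-1)(N-2)/3 - (u+u'+v+v') N(N-1)/2`. -/
def dConst (u u' v v' : ℂ) (N : ℕ) : ℝ :=
  (N : ℝ) * ((N : ℝ) - 1) * ((N : ℝ) - 2) / 3 -
    (u + u' + v + v').re * ((N : ℝ) * ((N : ℝ) - 1) / 2)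

open Classical in
/-- The matrix of transition rates on signatures of length `N`. -/
def rateN (u u' v v' : ℂ) (N : ℕ) (lam nu : Signature N) : ℝ :=
  dim nu / dim lam *
      ∑ i : Fin N, rateOne u u' v v' (coord lam i) (coord nu i) *
        (if ∀ j : Fin N, j ≠ i → coord lam j = coord nu j then 1 else 0) -
    dConst u u' v v' N * (if lam = nu then 1 else 0)

end GTChain

end

/-! The chain on signatures is a Doob transform of `N` independent birth and death processes. The
one-dimensional generator acts triangularly on polynomials: it sends `x ^ k` to `eigen k * x ^ k`
plus lower terms. Hence the Vandermonde determinant in the coordinates is an eigenfunction of the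
sum of `N` such generators, with eigenvalue `∑ k < N, eigen k = d_N`. Since `dim` is proportional to
this determinant, conjugating by `dim` and subtracting `d_N` gives rows with sum zero.

Everything else rests on one function, `lyap`, which is `1 + h₂` with `h₂` the complete symmetric
polynomial of degree 2 in the coordinates. By the bialternant formula, the transformed generator
sends `h₂` to a combination of `h₂`, `h₁` and `1`, so `|Q lyap| ≤ C * lyap`. Three facts follow.

Uniqueness: `lyap` has finite sublevel sets, so a maximum principle (`nonpos_of_backward`) shows
that bounded solutions of the backward equation are determined by their initial values. Comparing
the minimal solution with the constant `1` gives regularity.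

Determinant formula: `kmDet` solves the backward equation for `N` independent particles, by
multilinearity in the rows, and vanishes when two starting points coincide. Particles that jump by
at most one must collide before they change order, so after the Doob transform this is a bounded
solution for `rateN`. At time `0` it is the identity, and uniqueness identifies it with the
semigroup (`Admissible.semigroup_rateN_eq`).

Feller property: total jump rates are `O(lyap)` and a jump changes `lyap` by `O(√lyap)`, so `1 /
lyap` satisfies `Q g ≤ C * g` as well (`sum_mul_inv_le`). Hence `P(t) g ≤ exp(C t) g` with `g`
tending to `0` at infinity. The columns of `P(t)` therefore vanish at infinity, locally uniformly in
`t` (`isFellerSemigroup_of_le`). -/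

noncomputable section

namespace GTChain

open MeasureTheory Set Filter Topology

/-! ### Minimal solution: semigroup property, first-jump equation, comparison with supersolutions -/

section Chains

variable {E : Type*}

open Classical in
/-- The off-diagonal part of `Q` with values in `[0, ∞]`. -/
def jumpRate (Q : E → E → ℝ) (a c : E) : ℝ≥0∞ := if c = a then 0 else ENNReal.ofReal (Q a c)

lemma jumpTerm_succ (Q : E → E → ℝ) (n : ℕ) (t : ℝ) (a b : E) :
    jumpTerm Q (n + 1) t a b = ∫⁻ τ in Ioc 0 t, ENNReal.ofReal (Real.exp (τ * Q a a)) *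
      ∑' c : E, jumpRate Q a c * jumpTerm Q n (t - τ) c b := rfl

lemma measurable_lintegral_Ioc_convolution {k H : ℝ → ℝ≥0∞} (hk : Measurable k)
    (hH : Measurable H) : Measurable fun t : ℝ => ∫⁻ τ in Ioc 0 t, k τ * H (t - τ) := by
  have h1 : (fun t : ℝ => ∫⁻ τ in Ioc 0 t, k τ * H (t - τ)) = fun t : ℝ =>
      ∫⁻ τ, ({p : ℝ × ℝ | 0 < p.2 ∧ p.2 ≤ p.1}.indicator
        (fun p => k p.2 * H (p.1 - p.2))) (t, τ) := by
    funext t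
    rw [← lintegral_indicator measurableSet_Ioc]
    rfl
  rw [h1]
  refine Measurable.lintegral_prod_right' (Measurable.indicator (by fun_prop) ?_)
  exact (measurableSet_lt measurable_const measurable_snd).inter
    (measurableSet_le measurable_snd measurable_fst)

lemma measurable_jumpTerm [Countable E] (Q : E → E → ℝ) (n : ℕ) (a b : E) :
    Measurable fun t => jumpTerm Q n t a b := by
  induction n generalizing a with
  | zero =>
    simp only [jumpTerm]
    split_ifs
    · fun_prop
    · exact measurable_const
  | succ n ih =>
    simp only [jumpTerm_succ]
    exact measurable_lintegral_Ioc_convolution (by fun_prop)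
      (H := fun s => ∑' c : E, jumpRate Q a c * jumpTerm Q n s c b)
      (Measurable.tsum fun c => (ih c).const_mul _)

/-- Markov property at time `s`, sorted by the numbers of jumps before and after `s`. The induction
conditions on the first jump: if it comes after `s`, the pair `(0, n + 1)` results by a shift of the
integration variable; if it comes before, the induction hypothesis applies to the remaining time up
to `s`. -/
lemma jumpTerm_add [Countable E] (Q : E → E → ℝ) (n : ℕ) {s t : ℝ} (hs : 0 ≤ s) (ht : 0 ≤ t)
    (a b : E) : jumpTerm Q n (s + t) a b =
      ∑ p ∈ Finset.HasAntidiagonal.antidiagonal n, ∑' c, jumpTerm Q p.1 s a c * jumpTerm Q p.2 t c b := by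
  have hzero : ∀ (s : ℝ) (m : ℕ) (a : E), ∑' c, jumpTerm Q 0 s a c * jumpTerm Q m t c b =
      ENNReal.ofReal (Real.exp (s * Q a a)) * jumpTerm Q m t a b := by
    intro s m a
    rw [tsum_eq_single a]
    · simp [jumpTerm]
    · intro c hc
      simp [jumpTerm, hc.symm]
  induction n generalizing a s with
  | zero =>
    rw [Finset.Nat.antidiagonal_zero, Finset.sum_singleton, hzero]
    simp only [jumpTerm]
    split_ifs
    · rw [← ENNReal.ofReal_mul (Real.exp_nonneg _), ← Real.exp_add, add_mul]
    · simp
  | succ n ih =>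
    rw [Finset.Nat.antidiagonal_succ, Finset.sum_cons, Finset.sum_map, hzero, jumpTerm_succ,
      ← Ioc_union_Ioc_eq_Ioc hs (le_add_of_nonneg_right ht), lintegral_union measurableSet_Ioc
        (Ioc_disjoint_Ioc_of_le le_rfl), add_comm]
    congr 1
    · rw [jumpTerm_succ, ← lintegral_const_mul' _ _ ENNReal.ofReal_ne_top]
      rw [← lintegral_indicator measurableSet_Ioc, ← lintegral_indicator measurableSet_Ioc,
        ← lintegral_add_right_eq_self _ s]
      refine lintegral_congr fun τ => ?_
      by_cases hτ : τ ∈ Ioc 0 t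
      · rw [indicator_of_mem hτ, indicator_of_mem (by constructor <;> linarith [hτ.1, hτ.2]),
          ← mul_assoc, ← ENNReal.ofReal_mul (Real.exp_nonneg _), ← Real.exp_add]
        congr 3
        · ring
        · ext c
          congr 2
          ring
      · rw [indicator_of_notMem hτ, indicator_of_notMem]
        rintro ⟨h1, h2⟩
        exact hτ ⟨by linarith, by linarith⟩
    · have h1 : ∀ τ ∈ Ioc 0 s, ENNReal.ofReal (Real.exp (τ * Q a a)) *
          ∑' c : E, jumpRate Q a c * jumpTerm Q n (s + t - τ) c b =
          ∑ p ∈ Finset.HasAntidiagonal.antidiagonal n, ∑' d, (ENNReal.ofReal (Real.exp (τ * Q a a)) *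
            ∑' c : E, jumpRate Q a c * jumpTerm Q p.1 (s - τ) c d) * jumpTerm Q p.2 t d b := by
        intro τ hτ
        have h2 : ∀ c, jumpTerm Q n (s + t - τ) c b = ∑ p ∈ Finset.HasAntidiagonal.antidiagonal n,
            ∑' d, jumpTerm Q p.1 (s - τ) c d * jumpTerm Q p.2 t d b := by
          intro c
          rw [← ih (sub_nonneg.2 hτ.2)]
          congr 1
          ring
        simp_rw [h2, Finset.mul_sum]
        rw [Summable.tsum_finsetSum fun _ _ => ENNReal.summable, Finset.mul_sum]
        refine Finset.sum_congr rfl fun p _ => ?_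
        simp_rw [← ENNReal.tsum_mul_left, ← ENNReal.tsum_mul_right]
        rw [ENNReal.tsum_comm]
        simp only [mul_assoc]
      rw [setLIntegral_congr_fun measurableSet_Ioc h1]
      have hmeas : ∀ (m : ℕ) (d : E), Measurable fun τ => ENNReal.ofReal (Real.exp (τ * Q a a)) *
          ∑' c : E, jumpRate Q a c * jumpTerm Q m (s - τ) c d := fun m d => by
        refine Measurable.mul (by fun_prop) (Measurable.tsum fun c => ?_)
        exact ((measurable_jumpTerm Q m c d).comp (by fun_prop)).const_mul _
      rw [lintegral_finsetSum _ fun p _ => Measurable.tsum fun d =>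
        (hmeas p.1 d).mul_const _]
      refine Finset.sum_congr rfl fun p _ => ?_
      rw [lintegral_tsum fun d => ((hmeas p.1 d).mul_const _).aemeasurable]
      refine tsum_congr fun d => ?_
      rw [lintegral_mul_const _ (hmeas p.1 d)]
      rfl

lemma minimalSolution_add [Countable E] (Q : E → E → ℝ) {s t : ℝ} (hs : 0 ≤ s) (ht : 0 ≤ t)
    (a b : E) : minimalSolution Q (s + t) a b =
      ∑' c, minimalSolution Q s a c * minimalSolution Q t c b := by
  have h1 : ∀ c, minimalSolution Q s a c * minimalSolution Q t c b =
      ∑' p : ℕ × ℕ, jumpTerm Q p.1 s a c * jumpTerm Q p.2 t c b := by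
    intro c
    rw [ENNReal.tsum_prod (f := fun n m => jumpTerm Q n s a c * jumpTerm Q m t c b)]
    simp_rw [ENNReal.tsum_mul_left, ENNReal.tsum_mul_right]
    rfl
  simp_rw [h1, minimalSolution, jumpTerm_add Q _ hs ht]
  rw [ENNReal.tsum_comm, ← Finset.HasAntidiagonal.sigmaAntidiagonalEquivProd.tsum_eq, ENNReal.tsum_sigma']
  refine tsum_congr fun n => ?_
  rw [tsum_fintype, ← Finset.sum_coe_sort]
  rfl

open Classical in
lemma minimalSolution_eq [Countable E] (Q : E → E → ℝ) (t : ℝ) (a b : E) :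
    minimalSolution Q t a b = (if a = b then ENNReal.ofReal (Real.exp (t * Q a a)) else 0) +
      ∫⁻ τ in Ioc 0 t, ENNReal.ofReal (Real.exp (τ * Q a a)) *
        ∑' c : E, jumpRate Q a c * minimalSolution Q (t - τ) c b := by
  rw [minimalSolution, tsum_eq_zero_add' ENNReal.summable]
  congr 1
  simp_rw [jumpTerm_succ]
  rw [← lintegral_tsum]
  · refine lintegral_congr fun τ => ?_
    rw [ENNReal.tsum_mul_left, ENNReal.tsum_comm]
    simp_rw [ENNReal.tsum_mul_left]
    rfl
  · intro n
    refine (Measurable.mul (by fun_prop) (Measurable.tsum fun c => ?_)).aemeasurable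
    exact ((measurable_jumpTerm Q n c b).comp (by fun_prop)).const_mul _

lemma measurable_minimalSolution [Countable E] (Q : E → E → ℝ) (a b : E) :
    Measurable fun t => minimalSolution Q t a b :=
  Measurable.tsum fun n => measurable_jumpTerm Q n a b

/-- The function `P(t) h` for the minimal solution `P(t)`. -/
def act (Q : E → E → ℝ) (h : E → ℝ≥0∞) (t : ℝ) (a : E) : ℝ≥0∞ :=
  ∑' b, minimalSolution Q t a b * h b

lemma measurable_act [Countable E] (Q : E → E → ℝ) (h : E → ℝ≥0∞) (a : E) :
    Measurable fun t => act Q h t a :=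
  Measurable.tsum fun b => (measurable_minimalSolution Q a b).mul_const _

lemma act_eq [Countable E] (Q : E → E → ℝ) (h : E → ℝ≥0∞) (t : ℝ) (a : E) :
    act Q h t a = ENNReal.ofReal (Real.exp (t * Q a a)) * h a +
      ∫⁻ τ in Ioc 0 t, ENNReal.ofReal (Real.exp (τ * Q a a)) *
        ∑' c : E, jumpRate Q a c * act Q h (t - τ) c := by
  simp_rw [act]
  conv_lhs => enter [1, b]; rw [minimalSolution_eq, add_mul]
  rw [ENNReal.tsum_add]
  congr 1
  · rw [tsum_eq_single a]
    · simp
    · intro b hb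
      simp [hb.symm]
  · have hmeas : ∀ b, Measurable fun τ => ENNReal.ofReal (Real.exp (τ * Q a a)) *
        ∑' c : E, jumpRate Q a c * minimalSolution Q (t - τ) c b := fun b => by
      refine Measurable.mul (by fun_prop) (Measurable.tsum fun c => ?_)
      exact ((measurable_minimalSolution Q c b).comp (by fun_prop)).const_mul _
    rw [tsum_congr fun b => (lintegral_mul_const (h b) (hmeas b)).symm]
    rw [← lintegral_tsum fun b => ((hmeas b).mul_const _).aemeasurable]
    refine lintegral_congr fun τ => ?_
    simp_rw [← ENNReal.tsum_mul_left, ← ENNReal.tsum_mul_right]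
    rw [ENNReal.tsum_comm]
    simp only [mul_assoc]

/-- Together with the no-jump term `exp (t * q)`, this integral adds up to `exp (C * t)`; it closes
the induction in `act_le_of_jumpRate_le`. -/
lemma lintegral_exp_convolution {q C t : ℝ} (ht : 0 ≤ t) (hq : 0 ≤ C - q) :
    ∫⁻ τ in Ioc 0 t, ENNReal.ofReal (Real.exp (τ * q)) *
      (ENNReal.ofReal (C - q) * ENNReal.ofReal (Real.exp (C * (t - τ)))) =
    ENNReal.ofReal (Real.exp (C * t) - Real.exp (t * q)) := by
  have h1 : ∀ τ, ENNReal.ofReal (Real.exp (τ * q)) *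
      (ENNReal.ofReal (C - q) * ENNReal.ofReal (Real.exp (C * (t - τ)))) =
      ENNReal.ofReal ((C - q) * Real.exp (C * t + τ * (q - C))) := by
    intro τ
    rw [← ENNReal.ofReal_mul hq, ← ENNReal.ofReal_mul (Real.exp_nonneg _), mul_left_comm,
      ← Real.exp_add]
    congr 3
    ring
  have hcont : Continuous fun τ : ℝ => (C - q) * Real.exp (C * t + τ * (q - C)) := by fun_prop
  simp_rw [h1]
  rw [← ofReal_integral_eq_lintegral_ofReal]
  · rw [← intervalIntegral.integral_of_le ht, intervalIntegral.integral_eq_sub_of_hasDerivAt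
      (f := fun τ => -Real.exp (C * t + τ * (q - C)))]
    · congr 1
      simp only [zero_mul, add_zero]
      rw [show C * t + t * (q - C) = t * q by ring]
      ring
    · intro x _
      have h2 : HasDerivAt (fun τ : ℝ => C * t + τ * (q - C)) (q - C) x := by
        simpa using ((hasDerivAt_id x).mul_const (q - C)).const_add (C * t)
      exact h2.exp.neg.congr_deriv (by ring)
    · exact hcont.intervalIntegrable _ _
  · exact (hcont.integrableOn_Icc (μ := volume)).mono_set Ioc_subset_Icc_self
  · exact ae_of_all _ fun τ => mul_nonneg hq (Real.exp_nonneg _)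

/-- If `h ≥ 0` and `Q h ≤ C h`, then `P(t) h ≤ exp(C t) h`. -/
theorem act_le_of_jumpRate_le [Countable E] {Q : E → E → ℝ} {h : E → ℝ≥0∞} {C : ℝ}
    (hC : ∀ a, 0 ≤ C - Q a a)
    (hh : ∀ a, ∑' c, jumpRate Q a c * h c ≤ ENNReal.ofReal (C - Q a a) * h a)
    {t : ℝ} (ht : 0 ≤ t) (a : E) :
    act Q h t a ≤ ENNReal.ofReal (Real.exp (C * t)) * h a := by
  -- The bound is proved for paths with fewer than `M` jumps, by conditioning on the first jump. The
  -- minimal solution is the supremum of these partial sums.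
  have key : ∀ (M : ℕ) (t : ℝ), 0 ≤ t → ∀ a, ∑ n ∈ Finset.range M, ∑' b, jumpTerm Q n t a b * h b
      ≤ ENNReal.ofReal (Real.exp (C * t)) * h a := by
    intro M
    induction M with
    | zero => simp
    | succ M ih =>
      intro t ht a
      rw [Finset.sum_range_succ']
      have h0 : ∑' b, jumpTerm Q 0 t a b * h b = ENNReal.ofReal (Real.exp (t * Q a a)) * h a := by
        rw [tsum_eq_single a]
        · simp [jumpTerm]
        · intro b hb
          simp [jumpTerm, hb.symm]
      have hmeas : ∀ n b, Measurable fun τ => ENNReal.ofReal (Real.exp (τ * Q a a)) *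
          ∑' c : E, jumpRate Q a c * jumpTerm Q n (t - τ) c b := fun n b => by
        refine Measurable.mul (by fun_prop) (Measurable.tsum fun c => ?_)
        exact ((measurable_jumpTerm Q n c b).comp (by fun_prop)).const_mul _
      have h1 : ∑ n ∈ Finset.range M, ∑' b, jumpTerm Q (n + 1) t a b * h b =
          ∫⁻ τ in Ioc 0 t, ENNReal.ofReal (Real.exp (τ * Q a a)) * ∑' c, jumpRate Q a c *
            ∑ n ∈ Finset.range M, ∑' b, jumpTerm Q n (t - τ) c b * h b := by
        simp_rw [jumpTerm_succ]
        rw [Finset.sum_congr rfl fun n _ => (tsum_congr fun b =>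
          (lintegral_mul_const (h b) (hmeas n b)).symm).trans
            (lintegral_tsum fun b => ((hmeas n b).mul_const (h b)).aemeasurable).symm]
        rw [← lintegral_finsetSum _ fun n _ => Measurable.tsum fun b =>
          (hmeas n b).mul_const _]
        refine lintegral_congr fun τ => ?_
        simp_rw [Finset.mul_sum]
        rw [Summable.tsum_finsetSum fun _ _ => ENNReal.summable, Finset.mul_sum]
        refine Finset.sum_congr rfl fun p _ => ?_
        simp_rw [← ENNReal.tsum_mul_left, ← ENNReal.tsum_mul_right]
        rw [ENNReal.tsum_comm]
        simp only [mul_assoc]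
      have h2 : ∀ τ ∈ Ioc 0 t, ENNReal.ofReal (Real.exp (τ * Q a a)) * ∑' c, jumpRate Q a c *
            ∑ n ∈ Finset.range M, ∑' b, jumpTerm Q n (t - τ) c b * h b ≤
          ENNReal.ofReal (Real.exp (τ * Q a a)) * (ENNReal.ofReal (C - Q a a) *
            ENNReal.ofReal (Real.exp (C * (t - τ)))) * h a := by
        intro τ hτ
        rw [mul_assoc]
        gcongr
        calc _ ≤ ∑' c, jumpRate Q a c * (ENNReal.ofReal (Real.exp (C * (t - τ))) * h c) :=
              ENNReal.tsum_le_tsum fun c => by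
                gcongr
                exact ih _ (sub_nonneg.2 hτ.2) c
          _ = ENNReal.ofReal (Real.exp (C * (t - τ))) * ∑' c, jumpRate Q a c * h c := by
              rw [← ENNReal.tsum_mul_left]
              exact tsum_congr fun c => by ring
          _ ≤ ENNReal.ofReal (Real.exp (C * (t - τ))) * (ENNReal.ofReal (C - Q a a) * h a) := by
              gcongr
              exact hh a
          _ = _ := by ring
      rw [h0, h1]
      refine (add_le_add_left (setLIntegral_mono' measurableSet_Ioc h2) _).trans ?_
      rw [lintegral_mul_const _ (by fun_prop), lintegral_exp_convolution ht (hC a), ← add_mul,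
        ← ENNReal.ofReal_add _ (Real.exp_nonneg _), sub_add_cancel]
      rw [sub_nonneg, Real.exp_le_exp]
      nlinarith [hC a]
  have h3 : act Q h t a = ∑' n, ∑' b, jumpTerm Q n t a b * h b := by
    rw [act, ENNReal.tsum_comm]
    simp_rw [ENNReal.tsum_mul_right]
    rfl
  rw [h3]
  exact ENNReal.tsum_le_of_sum_range_le fun M => key M t ht a

end Chains

/-! ### Finite-range rates: the backward equation and a maximum principle -/

section FiniteRows

variable {E : Type*} {Q : E → E → ℝ} {S : E → Finset E}

open Classical in
lemma sum_erase_eq (hself : ∀ a, a ∈ S a) (f : E → ℝ) (a : E) :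
    ∑ c ∈ (S a).erase a, Q a c * f c = ∑ c ∈ S a, Q a c * f c - Q a a * f a := by
  rw [← Finset.sum_erase_add _ _ (hself a), add_sub_cancel_right]

open Classical in
lemma hasSum_offDiag (hS : ∀ a, ∀ b ∉ S a, Q a b = 0) (a : E) :
    HasSum (fun b : {b : E // b ≠ a} => Q a b) (∑ c ∈ S a, Q a c - Q a a) := by
  have h1 : HasSum (fun b => Q a b) (∑ c ∈ S a, Q a c) := hasSum_sum_of_ne_finset_zero (hS a)
  have h2 := (hasSum_subtype_iff_indicator (s := {b | b ≠ a}) (f := fun b => Q a b)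
    (a := ∑ c ∈ S a, Q a c - Q a a)).2
  have h3 : ({b | b ≠ a}.indicator fun b => Q a b) = fun b => Q a b - if b = a then Q a a else 0 := by
    funext b
    by_cases hb : b = a
    · simp [hb]
    · simp [indicator, hb]
  exact h2 (h3 ▸ h1.sub (hasSum_ite_eq a (Q a a)))

lemma isRateMatrix_of_sum_eq_zero (hoff : ∀ a b, a ≠ b → 0 ≤ Q a b)
    (hS : ∀ a, ∀ b ∉ S a, Q a b = 0) (hsum : ∀ a, ∑ b ∈ S a, Q a b = 0) :
    IsRateMatrix Q :=
  ⟨hoff, fun a => by simpa [hsum] using hasSum_offDiag hS a⟩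

lemma IsRateMatrix.sum_eq_zero (hQ : IsRateMatrix Q) (hS : ∀ a, ∀ b ∉ S a, Q a b = 0)
    (a : E) : ∑ b ∈ S a, Q a b = 0 := by
  have h := (hQ.row_sum a).unique (hasSum_offDiag hS a)
  linarith

lemma IsRateMatrix.diag_nonpos (hQ : IsRateMatrix Q) (a : E) : Q a a ≤ 0 := by
  have h := (hQ.row_sum a).nonneg fun b : {b : E // b ≠ a} =>
    hQ.offDiag_nonneg a b b.2.symm
  linarith

open Classical in
lemma tsum_jumpRate_mul (hS : ∀ a, ∀ b ∉ S a, Q a b = 0) (F : E → ℝ≥0∞) (a : E) :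
    ∑' c, jumpRate Q a c * F c = ∑ c ∈ (S a).erase a, ENNReal.ofReal (Q a c) * F c := by
  rw [tsum_eq_sum (s := (S a).erase a)]
  · refine Finset.sum_congr rfl fun c hc => ?_
    rw [jumpRate, if_neg (Finset.ne_of_mem_erase hc)]
  · intro c hc
    rw [jumpRate]
    split_ifs with h
    · simp
    · simp [hS a c fun h' => hc (Finset.mem_erase.2 ⟨h, h'⟩)]

lemma tsum_jumpRate_mul_ofReal (hQ : IsRateMatrix Q) (hS : ∀ a, ∀ b ∉ S a, Q a b = 0)
    (hself : ∀ a, a ∈ S a) {f : E → ℝ} (hf : ∀ a, 0 ≤ f a) (a : E) :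
    ∑' c, jumpRate Q a c * ENNReal.ofReal (f c) =
      ENNReal.ofReal (∑ c ∈ S a, Q a c * f c - Q a a * f a) := by
  classical
  have h0 : ∀ c ∈ (S a).erase a, 0 ≤ Q a c := fun c hc =>
    hQ.offDiag_nonneg a c (Finset.ne_of_mem_erase hc).symm
  rw [tsum_jumpRate_mul hS, ← sum_erase_eq hself, ENNReal.ofReal_sum_of_nonneg fun c hc =>
    mul_nonneg (h0 c hc) (hf c)]
  exact Finset.sum_congr rfl fun c hc => (ENNReal.ofReal_mul (h0 c hc)).symm

/-- If `f ≥ 0` and `Q f ≤ C f`, then `P(t) f ≤ exp(C t) f`. -/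
theorem act_ofReal_le [Countable E] (hQ : IsRateMatrix Q) (hS : ∀ a, ∀ b ∉ S a, Q a b = 0)
    (hself : ∀ a, a ∈ S a) {f : E → ℝ} (hf : ∀ a, 0 ≤ f a) {C : ℝ} (hC : 0 ≤ C)
    (hQf : ∀ a, ∑ b ∈ S a, Q a b * f b ≤ C * f a) {t : ℝ} (ht : 0 ≤ t) (a : E) :
    act Q (fun b => ENNReal.ofReal (f b)) t a ≤ ENNReal.ofReal (Real.exp (C * t) * f a) := by
  have hd : ∀ a, 0 ≤ C - Q a a := fun a => by linarith [hQ.diag_nonpos a]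
  rw [ENNReal.ofReal_mul (Real.exp_nonneg _)]
  refine act_le_of_jumpRate_le hd (fun a => ?_) ht a
  rw [tsum_jumpRate_mul_ofReal hQ hS hself hf, ← ENNReal.ofReal_mul (hd a)]
  exact ENNReal.ofReal_le_ofReal (by linarith [hQf a])

lemma act_le_one [Countable E] (hQ : IsRateMatrix Q) (hS : ∀ a, ∀ b ∉ S a, Q a b = 0)
    (hself : ∀ a, a ∈ S a) {h : E → ℝ≥0∞} (hh : ∀ a, h a ≤ 1) {t : ℝ} (ht : 0 ≤ t) (a : E) :
    act Q h t a ≤ 1 := by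
  have h1 := act_ofReal_le hQ hS hself (f := fun _ => 1) (fun _ => zero_le_one) le_rfl
    (fun a => by simp [hQ.sum_eq_zero hS a]) ht a
  simp only [ENNReal.ofReal_one, zero_mul, Real.exp_zero, mul_one] at h1
  exact (ENNReal.tsum_le_tsum fun b => mul_le_mul_right (hh b) _).trans h1

/-- The sum over the jumps away from `a`, in the backward equation. -/
def inflow (Q : E → E → ℝ) (S : E → Finset E) (h : E → ℝ≥0∞) (a : E) (t : ℝ) : ℝ :=
  open Classical in ∑ c ∈ (S a).erase a, Q a c * (act Q h (max t 0) c).toReal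

lemma measurable_inflow [Countable E] (h : E → ℝ≥0∞) (a : E) : Measurable (inflow Q S h a) := by
  classical
  refine Finset.measurable_sum _ fun c _ => Measurable.const_mul ?_ _
  exact ((measurable_act Q h c).comp (by fun_prop : Measurable fun t : ℝ => max t 0)).ennreal_toReal

lemma inflow_nonneg (hQ : IsRateMatrix Q) (h : E → ℝ≥0∞) (a : E) (t : ℝ) :
    0 ≤ inflow Q S h a t := by
  classical
  exact Finset.sum_nonneg fun c hc => mul_nonneg
    (hQ.offDiag_nonneg a c (Finset.ne_of_mem_erase hc).symm) ENNReal.toReal_nonneg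

/-- The truncation `max t 0` in `inflow` makes this bound valid at every real time, so that
integrability holds on arbitrary intervals. -/
lemma inflow_le [Countable E] (hQ : IsRateMatrix Q) (hS : ∀ a, ∀ b ∉ S a, Q a b = 0)
    (hself : ∀ a, a ∈ S a) {h : E → ℝ≥0∞} (hh : ∀ a, h a ≤ 1) (a : E) (t : ℝ) :
    inflow Q S h a t ≤ -Q a a := by
  classical
  have h1 : ∑ c ∈ (S a).erase a, Q a c * 1 = -Q a a := by
    rw [sum_erase_eq hself]
    simp [hQ.sum_eq_zero hS a]
  rw [← h1]
  refine Finset.sum_le_sum fun c hc => mul_le_mul_of_nonneg_left ?_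
    (hQ.offDiag_nonneg a c (Finset.ne_of_mem_erase hc).symm)
  exact ENNReal.toReal_le_of_le_ofReal zero_le_one
    (by simpa using act_le_one hQ hS hself hh (le_max_right t 0) c)

lemma intervalIntegrable_inflow [Countable E] (hQ : IsRateMatrix Q)
    (hS : ∀ a, ∀ b ∉ S a, Q a b = 0) (hself : ∀ a, a ∈ S a) {h : E → ℝ≥0∞}
    (hh : ∀ a, h a ≤ 1) (a : E) {k : ℝ → ℝ} (hk : Continuous k) (x y : ℝ) :
    IntervalIntegrable (fun σ => k σ * inflow Q S h a σ) volume x y := by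
  refine IntervalIntegrable.continuousOn_mul ?_ hk.continuousOn
  refine (intervalIntegrable_const (c := -Q a a)).mono_fun
    (measurable_inflow h a).aestronglyMeasurable (ae_of_all _ fun t => ?_)
  beta_reduce
  rw [Real.norm_of_nonneg (inflow_nonneg hQ h a t),
    Real.norm_of_nonneg (by linarith [hQ.diag_nonpos a])]
  exact inflow_le hQ hS hself hh a t

/-- Reversing time by `σ = t - τ` takes the dependence on `t` out of the integrand. A bounded
measurable integrand then gives continuity of `P(t) h`; continuity of all entries makes `inflow`
continuous, and that gives differentiability. -/
lemma act_toReal_eq [Countable E] (hQ : IsRateMatrix Q) (hS : ∀ a, ∀ b ∉ S a, Q a b = 0)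
    (hself : ∀ a, a ∈ S a) {h : E → ℝ≥0∞} (hh : ∀ a, h a ≤ 1) {t : ℝ} (ht : 0 ≤ t) (a : E) :
    (act Q h t a).toReal = Real.exp (t * Q a a) *
      ((h a).toReal + ∫ σ in (0)..t, Real.exp (-(σ * Q a a)) * inflow Q S h a σ) := by
  classical
  have h1 : ∀ τ ∈ Ioc 0 t, ENNReal.ofReal (Real.exp (τ * Q a a)) *
      ∑' c : E, jumpRate Q a c * act Q h (t - τ) c =
      ENNReal.ofReal (Real.exp (τ * Q a a) * inflow Q S h a (t - τ)) := by
    intro τ hτ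
    rw [ENNReal.ofReal_mul (Real.exp_nonneg _), tsum_jumpRate_mul hS, inflow,
      ENNReal.ofReal_sum_of_nonneg]
    · congr 1
      refine Finset.sum_congr rfl fun c hc => ?_
      rw [ENNReal.ofReal_mul (hQ.offDiag_nonneg a c (Finset.ne_of_mem_erase hc).symm),
        ENNReal.ofReal_toReal, max_eq_left (sub_nonneg.2 hτ.2)]
      exact ne_top_of_le_ne_top ENNReal.one_ne_top (act_le_one hQ hS hself hh (le_max_right _ _) c)
    · exact fun c hc => mul_nonneg
        (hQ.offDiag_nonneg a c (Finset.ne_of_mem_erase hc).symm) ENNReal.toReal_nonneg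
  have hfin : h a ≠ ⊤ := ne_top_of_le_ne_top ENNReal.one_ne_top (hh a)
  have hint : IntervalIntegrable (fun τ => Real.exp (τ * Q a a) * inflow Q S h a (t - τ))
      volume 0 t := by
    refine IntervalIntegrable.continuousOn_mul ?_ (by fun_prop)
    have := (intervalIntegrable_inflow hQ hS hself hh a (continuous_const (y := 1)) t 0).comp_sub_left t
    simpa using this
  rw [act_eq, setLIntegral_congr_fun measurableSet_Ioc h1, ← ofReal_integral_eq_lintegral_ofReal,
    ← intervalIntegral.integral_of_le ht, ENNReal.toReal_add (by finiteness) (by finiteness),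
    ENNReal.toReal_mul, ENNReal.toReal_ofReal (Real.exp_nonneg _), ENNReal.toReal_ofReal, mul_add,
    ← intervalIntegral.integral_const_mul]
  · congr 1
    have h2 := intervalIntegral.integral_comp_sub_left (a := 0) (b := t)
      (fun σ => Real.exp (t * Q a a) * (Real.exp (-(σ * Q a a)) * inflow Q S h a σ)) t
    rw [sub_self, sub_zero] at h2
    rw [← h2]
    congr 1
    ext σ
    rw [← mul_assoc, ← Real.exp_add]
    congr 2
    ring
  · exact intervalIntegral.integral_nonneg ht fun τ _ =>
      mul_nonneg (Real.exp_nonneg _) (inflow_nonneg hQ h a _)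
  · exact (intervalIntegrable_iff_integrableOn_Ioc_of_le ht).1 hint
  · exact ae_of_all _ fun τ => mul_nonneg (Real.exp_nonneg _) (inflow_nonneg hQ h a _)

lemma act_zero [Countable E] (h : E → ℝ≥0∞) (a : E) : act Q h 0 a = h a := by
  rw [act_eq]
  simp

lemma continuousOn_act_toReal [Countable E] (hQ : IsRateMatrix Q)
    (hS : ∀ a, ∀ b ∉ S a, Q a b = 0) (hself : ∀ a, a ∈ S a) {h : E → ℝ≥0∞}
    (hh : ∀ a, h a ≤ 1) (a : E) : ContinuousOn (fun t => (act Q h t a).toReal) (Ici 0) := by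
  refine ContinuousOn.congr (Continuous.continuousOn ?_)
    fun t ht => act_toReal_eq hQ hS hself hh ht a
  have := intervalIntegral.continuous_primitive
    (fun x y => intervalIntegrable_inflow (k := fun σ => Real.exp (-(σ * Q a a)))
      hQ hS hself hh a (by fun_prop) x y) 0
  fun_prop

/-- The backward equation for `P(t) h`. -/
lemma hasDerivAt_act_toReal [Countable E] (hQ : IsRateMatrix Q)
    (hS : ∀ a, ∀ b ∉ S a, Q a b = 0) (hself : ∀ a, a ∈ S a) {h : E → ℝ≥0∞}
    (hh : ∀ a, h a ≤ 1) {t : ℝ} (ht : 0 < t) (a : E) :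
    HasDerivAt (fun t => (act Q h t a).toReal) (∑ b ∈ S a, Q a b * (act Q h t b).toReal) t := by
  classical
  have hcont : Continuous (inflow Q S h a) := by
    refine continuous_finsetSum _ fun c _ => continuous_const.mul ?_
    exact (continuousOn_act_toReal hQ hS hself hh c).comp_continuous (by fun_prop)
      fun t => le_max_right t 0
  have h1 : HasDerivAt (fun t => ∫ σ in (0)..t, Real.exp (-(σ * Q a a)) * inflow Q S h a σ)
      (Real.exp (-(t * Q a a)) * inflow Q S h a t) t :=
    (Continuous.integral_hasStrictDerivAt (by fun_prop) 0 t).hasDerivAt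
  have h2 : HasDerivAt (fun t => Real.exp (t * Q a a)) (Real.exp (t * Q a a) * Q a a) t := by
    simpa using ((hasDerivAt_id t).mul_const (Q a a)).exp
  have h3 := h2.mul (h1.const_add (h a).toReal)
  refine (h3.congr_of_eventuallyEq ?_).congr_deriv ?_
  · filter_upwards [Ioi_mem_nhds ht] with s hs using act_toReal_eq hQ hS hself hh hs.le a
  · rw [← mul_assoc, ← Real.exp_add, add_neg_cancel, Real.exp_zero, one_mul, mul_right_comm,
      ← act_toReal_eq hQ hS hself hh ht.le a, inflow, max_eq_left ht.le, sum_erase_eq hself]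
    ring

/-- A maximum principle: if `f ≥ 0` has finite sublevel sets and `Q f ≤ C f`, then a bounded
solution of the backward equation that starts nonpositive stays nonpositive. -/
theorem nonpos_of_backward (hQ : IsRateMatrix Q) (hS : ∀ a, ∀ b ∉ S a, Q a b = 0)
    {f : E → ℝ} (hf : ∀ a, 0 ≤ f a) (hfin : ∀ K, {a | f a ≤ K}.Finite)
    {C : ℝ} (hC : 0 ≤ C) (hQf : ∀ a, ∑ b ∈ S a, Q a b * f b ≤ C * f a) {w : ℝ → E → ℝ} {T : ℝ}
    (hT : 0 ≤ T) (hcont : ∀ a, ContinuousOn (fun t => w t a) (Icc 0 T))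
    (hderiv : ∀ a, ∀ t ∈ Ioc 0 T, HasDerivAt (fun t => w t a) (∑ b ∈ S a, Q a b * w t b) t)
    {B : ℝ} (hB : ∀ t ∈ Icc 0 T, ∀ a, w t a ≤ B) (h0 : ∀ a, w 0 a ≤ 0) (a : E) : w T a ≤ 0 := by
  classical
  by_contra! hpos
  -- The damping rate has to be at least `C`, to absorb `Q f ≤ C f`, and strictly positive, to give
  -- a strict sign at a positive maximum.
  set K := C + 1 with hK
  obtain ⟨ε, hε, hε'⟩ : ∃ ε > 0, ε * f a < Real.exp (-(K * T)) * w T a := by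
    refine ⟨Real.exp (-(K * T)) * w T a / (f a + 1), by have := hf a; positivity, ?_⟩
    have := hf a
    rw [div_mul_eq_mul_div, div_lt_iff₀ (by positivity)]
    have : 0 < Real.exp (-(K * T)) * w T a := by positivity
    nlinarith
  -- The penalty `ε * f` forces a positive maximum to be attained: outside the finite set `F` below
  -- it exceeds the bound on `w`. The choice of `ε` keeps `g T a` positive.
  set g : ℝ → E → ℝ := fun t b => Real.exp (-(K * t)) * w t b - ε * f b with hg
  have hgcont : ∀ b, ContinuousOn (fun t => g t b) (Icc 0 T) := fun b => by
    have := hcont b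
    fun_prop
  set F : Set E := {b | f b ≤ |B| / ε} with hF
  have hout : ∀ t ∈ Icc 0 T, ∀ b, b ∉ F → g t b ≤ 0 := by
    intro t ht b hb
    have h1 : |B| < ε * f b := by
      rw [hF, mem_ofPred_eq, not_le, div_lt_iff₀ hε] at hb
      linarith
    have h2 : Real.exp (-(K * t)) ≤ 1 := by
      rw [Real.exp_le_one_iff]
      have := ht.1
      have : 0 ≤ K := by linarith
      nlinarith
    have h3 : Real.exp (-(K * t)) * w t b ≤ |B| := by
      calc _ ≤ Real.exp (-(K * t)) * |B| := by
            gcongr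
            exact (hB t ht b).trans (le_abs_self B)
        _ ≤ 1 * |B| := by gcongr
        _ = |B| := one_mul _
    simp only [hg]
    linarith
  have hTmem : T ∈ Icc 0 T := ⟨hT, le_rfl⟩
  have hga : 0 < g T a := by
    simp only [hg]
    linarith
  have haF : a ∈ F := by
    by_contra h
    exact absurd (hout T hTmem a h) (not_le.2 hga)
  have hmax : ∀ b, ∃ t ∈ Icc 0 T, ∀ s ∈ Icc 0 T, g s b ≤ g t b := fun b =>
    isCompact_Icc.exists_isMaxOn ⟨T, hTmem⟩ (hgcont b)
  choose τ hτ hτmax using hmax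
  obtain ⟨b, hbF, hb⟩ := (hfin (|B| / ε)).exists_maximalFor (fun b => g (τ b) b) F ⟨a, haF⟩
  have hall : ∀ s ∈ Icc 0 T, ∀ c, g s c ≤ g (τ b) b := by
    have hbpos : 0 < g (τ b) b := by
      have h1 : g (τ a) a ≤ g (τ b) b := by
        rcases le_total (g (τ a) a) (g (τ b) b) with h | h
        · exact h
        · exact hb haF h
      exact (hga.trans_le (hτmax a T hTmem)).trans_le h1
    intro s hs c
    by_cases hc : c ∈ F
    · refine (hτmax c s hs).trans ?_
      rcases le_total (g (τ c) c) (g (τ b) b) with h | h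
      · exact h
      · exact hb hc h
    · exact (hout s hs c hc).trans hbpos.le
  set t := τ b with ht
  have hgpos : 0 < g t b := hga.trans_le (hall T hTmem a)
  have htpos : 0 < t := by
    refine lt_of_le_of_ne (hτ b).1 fun h => ?_
    rw [← h] at hgpos
    simp only [hg, mul_zero, neg_zero, Real.exp_zero, one_mul] at hgpos
    nlinarith [h0 b, hf b]
  have hd : HasDerivAt (fun s => g s b) (-K * Real.exp (-(K * t)) * w t b +
      Real.exp (-(K * t)) * ∑ c ∈ S b, Q b c * w t c) t := by
    have h1 : HasDerivAt (fun s : ℝ => Real.exp (-(K * s))) (-K * Real.exp (-(K * t))) t := by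
      have := (((hasDerivAt_id t).const_mul K).neg).exp
      simp only [id_eq, mul_one] at this
      exact this.congr_deriv (mul_comm _ _)
    exact ((h1.mul (hderiv b t ⟨htpos, (hτ b).2⟩)).sub_const _)
  -- At a spatial maximum `Q g ≤ 0`: since the row sums to zero, only the differences `g t c - g t b
  -- ≤ 0` count, with nonnegative rates.
  have hQg : ∑ c ∈ S b, Q b c * g t c ≤ 0 := by
    have h1 : ∑ c ∈ S b, Q b c * g t c = ∑ c ∈ S b, Q b c * (g t c - g t b) := by
      simp_rw [mul_sub]
      rw [Finset.sum_sub_distrib, ← Finset.sum_mul, hQ.sum_eq_zero hS, zero_mul, sub_zero]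
    rw [h1]
    refine Finset.sum_nonpos fun c _ => ?_
    by_cases hcb : b = c
    · simp [hcb]
    · exact mul_nonpos_of_nonneg_of_nonpos (hQ.offDiag_nonneg b c hcb)
        (sub_nonpos.2 (hall t (hτ b) c))
  have hQw : Real.exp (-(K * t)) * ∑ c ∈ S b, Q b c * w t c =
      ∑ c ∈ S b, Q b c * g t c + ε * ∑ c ∈ S b, Q b c * f c := by
    rw [Finset.mul_sum, Finset.mul_sum, ← Finset.sum_add_distrib]
    refine Finset.sum_congr rfl fun c _ => ?_
    simp only [hg]
    ring
  have hneg : -K * Real.exp (-(K * t)) * w t b +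
      Real.exp (-(K * t)) * ∑ c ∈ S b, Q b c * w t c < 0 := by
    rw [hQw]
    have h1 : -K * Real.exp (-(K * t)) * w t b = -K * g t b - K * (ε * f b) := by
      simp only [hg]
      ring
    have h2 : ε * ∑ c ∈ S b, Q b c * f c ≤ ε * (C * f b) := by
      gcongr
      exact hQf b
    have h3 : 0 ≤ ε * f b := mul_nonneg hε.le (hf b)
    have h4 : 0 < K * g t b := mul_pos (by linarith) hgpos
    nlinarith
  have hnonneg : 0 ≤ -K * Real.exp (-(K * t)) * w t b +
      Real.exp (-(K * t)) * ∑ c ∈ S b, Q b c * w t c := by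
    -- Only slopes from the left are used, because the maximum may sit at the endpoint `T`.
    refine ge_of_tendsto (hd.tendsto_slope.mono_left (nhdsLT_le_nhdsNE t)) ?_
    filter_upwards [Ioo_mem_nhdsLT htpos] with s hs
    rw [slope_def_field]
    exact div_nonneg_of_nonpos
      (sub_nonpos.2 (hall s ⟨hs.1.le, hs.2.le.trans (hτ b).2⟩ b)) (sub_nonpos.2 hs.2.le)
  exact absurd hnonneg (not_le.2 hneg)

end FiniteRows

/-! ### Consequences of a Lyapunov function: uniqueness, regularity, the Markov semigroup -/

section Lyapunov

variable {E : Type*} {Q : E → E → ℝ} {S : E → Finset E}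

/-- `f ≥ 0` has finite sublevel sets and `Q f ≤ C f`. -/
structure IsLyapunov (Q : E → E → ℝ) (S : E → Finset E) (f : E → ℝ) (C : ℝ) : Prop where
  nonneg : ∀ a, 0 ≤ f a
  finite_le : ∀ K, {a | f a ≤ K}.Finite
  const_nonneg : 0 ≤ C
  le : ∀ a, ∑ b ∈ S a, Q a b * f b ≤ C * f a

/-- Bounded solutions of the backward equation are unique if there is a Lyapunov function. -/
theorem act_toReal_eq_of_backward [Countable E] (hQ : IsRateMatrix Q) (hS : ∀ a, ∀ b ∉ S a, Q a b = 0)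
    (hself : ∀ a, a ∈ S a) {f : E → ℝ} {C : ℝ} (hf : IsLyapunov Q S f C)
    {h : E → ℝ≥0∞} (hh : ∀ a, h a ≤ 1) {w : ℝ → E → ℝ}
    (hcont : ∀ a, ContinuousOn (fun t => w t a) (Ici 0))
    (hderiv : ∀ a t, 0 < t → HasDerivAt (fun t => w t a) (∑ b ∈ S a, Q a b * w t b) t)
    {T B : ℝ} (hT : 0 ≤ T) (hB : ∀ t ∈ Icc 0 T, ∀ a, |w t a| ≤ B) (h0 : ∀ a, w 0 a = (h a).toReal)
    (a : E) : w T a = (act Q h T a).toReal := by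
  have hle : ∀ t ∈ Icc 0 T, ∀ a, (act Q h t a).toReal ≤ 1 := fun t ht a =>
    ENNReal.toReal_le_of_le_ofReal zero_le_one
      (by simpa using act_le_one hQ hS hself hh ht.1 a)
  refine le_antisymm (sub_nonpos.1 ?_) (sub_nonpos.1 ?_)
  · refine nonpos_of_backward hQ hS hf.nonneg hf.finite_le hf.const_nonneg hf.le
      (w := fun t a => w t a - (act Q h t a).toReal) (B := B) hT (fun a => ?_) (fun a t ht => ?_)
      (fun t ht a => ?_) (fun a => ?_) a
    · exact ((hcont a).sub (continuousOn_act_toReal hQ hS hself hh a)).mono Icc_subset_Ici_self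
    · refine ((hderiv a t ht.1).sub (hasDerivAt_act_toReal hQ hS hself hh ht.1 a)).congr_deriv ?_
      simp_rw [mul_sub, Finset.sum_sub_distrib]
    · have h1 : 0 ≤ (act Q h t a).toReal := ENNReal.toReal_nonneg
      linarith [le_abs_self (w t a), hB t ht a]
    · simp [act_zero, h0]
  · refine nonpos_of_backward hQ hS hf.nonneg hf.finite_le hf.const_nonneg hf.le
      (w := fun t a => (act Q h t a).toReal - w t a) (B := 1 + B) hT (fun a => ?_)
      (fun a t ht => ?_) (fun t ht a => ?_) (fun a => ?_) a
    · exact ((continuousOn_act_toReal hQ hS hself hh a).sub (hcont a)).mono Icc_subset_Ici_self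
    · refine ((hasDerivAt_act_toReal hQ hS hself hh ht.1 a).sub (hderiv a t ht.1)).congr_deriv ?_
      simp_rw [mul_sub, Finset.sum_sub_distrib]
    · have h1 := hle t ht a
      linarith [neg_abs_le (w t a), hB t ht a]
    · simp [act_zero, h0]

lemma tsum_minimalSolution (t : ℝ) (a : E) :
    ∑' b, minimalSolution Q t a b = act Q (fun _ => 1) t a := by
  simp [act]

/-- Rows sum to zero, so the constant `1` is a bounded solution of the backward equation; by
uniqueness it equals `P(t) 1`. -/
theorem isRegularRateMatrix_of_isLyapunov [Countable E] (hQ : IsRateMatrix Q)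
    (hS : ∀ a, ∀ b ∉ S a, Q a b = 0) (hself : ∀ a, a ∈ S a) {f : E → ℝ} {C : ℝ}
    (hf : IsLyapunov Q S f C) : IsRegularRateMatrix Q := by
  refine ⟨hQ, fun t ht a => ?_⟩
  have h1 := act_toReal_eq_of_backward hQ hS hself hf (h := fun _ => 1) (fun _ => le_rfl)
    (w := fun _ _ => 1) (fun _ => continuousOn_const)
    (fun a t _ => by simpa [hQ.sum_eq_zero hS a] using hasDerivAt_const t (1 : ℝ)) ht (B := 1)
    (fun _ _ _ => by simp) (fun _ => by simp) a
  rw [tsum_minimalSolution]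
  have h2 : act Q (fun _ => 1) t a ≠ ⊤ :=
    ne_top_of_le_ne_top ENNReal.one_ne_top (act_le_one hQ hS hself (fun _ => le_rfl) ht a)
  rw [← ENNReal.ofReal_toReal h2, ← h1, ENNReal.ofReal_one]

open Classical in
lemma act_single (t : ℝ) (a b : E) :
    act Q (fun c => if c = b then 1 else 0) t a = minimalSolution Q t a b := by
  simp [act]

lemma minimalSolution_le_one [Countable E] (hQ : IsRateMatrix Q)
    (hS : ∀ a, ∀ b ∉ S a, Q a b = 0) (hself : ∀ a, a ∈ S a) {t : ℝ} (ht : 0 ≤ t) (a b : E) :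
    minimalSolution Q t a b ≤ 1 := by
  classical
  rw [← act_single]
  exact act_le_one hQ hS hself (fun c => by split_ifs <;> simp) ht a

lemma semigroup_nonneg (t : ℝ) (a b : E) : 0 ≤ semigroup Q t a b := ENNReal.toReal_nonneg

lemma semigroup_le_one [Countable E] (hQ : IsRateMatrix Q)
    (hS : ∀ a, ∀ b ∉ S a, Q a b = 0) (hself : ∀ a, a ∈ S a) {t : ℝ} (ht : 0 ≤ t) (a b : E) :
    semigroup Q t a b ≤ 1 :=
  ENNReal.toReal_le_of_le_ofReal zero_le_one
    (by simpa using minimalSolution_le_one hQ hS hself ht a b)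

open Classical in
lemma semigroup_zero [Countable E] (a b : E) : semigroup Q 0 a b = if a = b then 1 else 0 := by
  rw [semigroup, ← act_single, act_zero]
  split_ifs <;> simp

lemma continuousOn_semigroup [Countable E] (hQ : IsRateMatrix Q)
    (hS : ∀ a, ∀ b ∉ S a, Q a b = 0) (hself : ∀ a, a ∈ S a) (a b : E) :
    ContinuousOn (fun t => semigroup Q t a b) (Ici 0) := by
  classical
  simp_rw [semigroup, ← act_single]
  exact continuousOn_act_toReal hQ hS hself (fun c => by split_ifs <;> simp) a

lemma hasDerivAt_semigroup [Countable E] (hQ : IsRateMatrix Q)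
    (hS : ∀ a, ∀ b ∉ S a, Q a b = 0) (hself : ∀ a, a ∈ S a) {t : ℝ} (ht : 0 < t) (a b : E) :
    HasDerivAt (fun t => semigroup Q t a b) (∑ c ∈ S a, Q a c * semigroup Q t c b) t := by
  classical
  simp_rw [semigroup, ← act_single]
  exact hasDerivAt_act_toReal hQ hS hself (fun c => by split_ifs <;> simp) ht a

open Classical in
theorem eq_semigroup_of_backward [Countable E] (hQ : IsRateMatrix Q) (hS : ∀ a, ∀ b ∉ S a, Q a b = 0)
    (hself : ∀ a, a ∈ S a) {f : E → ℝ} {C : ℝ} (hf : IsLyapunov Q S f C) (b : E)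
    {w : ℝ → E → ℝ} (hcont : ∀ a, ContinuousOn (fun t => w t a) (Ici 0))
    (hderiv : ∀ a t, 0 < t → HasDerivAt (fun t => w t a) (∑ c ∈ S a, Q a c * w t c) t)
    {T B : ℝ} (hT : 0 ≤ T) (hB : ∀ t ∈ Icc 0 T, ∀ a, |w t a| ≤ B)
    (h0 : ∀ a, w 0 a = if a = b then 1 else 0) (a : E) : w T a = semigroup Q T a b := by
  rw [semigroup, ← act_single]
  refine act_toReal_eq_of_backward hQ hS hself hf (fun c => by split_ifs <;> simp)
    hcont hderiv hT hB (fun a => ?_) a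
  rw [h0]
  split_ifs <;> simp

theorem isMarkovSemigroup_semigroup [Countable E] (hQ : IsRegularRateMatrix Q) :
    IsMarkovSemigroup (semigroup Q) where
  nonneg t _ a b := semigroup_nonneg t a b
  stochastic t ht a := by
    have h1 := hQ.stochastic t ht a
    have h2 := ENNReal.hasSum_toReal (h1 ▸ ENNReal.one_ne_top)
    rwa [← ENNReal.tsum_toReal_eq fun b => ENNReal.ne_top_of_tsum_ne_top (h1 ▸ ENNReal.one_ne_top) b,
      h1, ENNReal.toReal_one] at h2
  zero := semigroup_zero
  chapman_kolmogorov s t hs ht a b := by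
    have hne : ∀ {t : ℝ}, 0 ≤ t → ∀ a b, minimalSolution Q t a b ≠ ⊤ := fun ht a b =>
      ENNReal.ne_top_of_tsum_ne_top (hQ.stochastic _ ht a ▸ ENNReal.one_ne_top) b
    have h1 := minimalSolution_add Q hs ht a b
    have h2 := ENNReal.hasSum_toReal (h1 ▸ hne (add_nonneg hs ht) a b)
    rw [← ENNReal.tsum_toReal_eq fun c => ENNReal.mul_ne_top (hne hs a c) (hne ht c b), ← h1] at h2
    simpa only [semigroup, ENNReal.toReal_mul] using h2

/-- One term of the series in `P(t) g ≤ exp(C t) g`. It is meant for `g` vanishing at infinity,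
where it shows that each column decays in `a`. -/
lemma semigroup_le_of_supersolution [Countable E] (hQ : IsRateMatrix Q) (hS : ∀ a, ∀ b ∉ S a, Q a b = 0)
    (hself : ∀ a, a ∈ S a) {g : E → ℝ} (hg : ∀ a, 0 < g a) {C : ℝ} (hC : 0 ≤ C)
    (hQg : ∀ a, ∑ b ∈ S a, Q a b * g b ≤ C * g a) {t : ℝ} (ht : 0 ≤ t) (a b : E) :
    semigroup Q t a b ≤ Real.exp (C * t) * g a / g b := by
  have h1 := act_ofReal_le hQ hS hself (fun a => (hg a).le) hC hQg ht a
  have h2 := (ENNReal.le_tsum b).trans h1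
  rw [le_div_iff₀ (hg b), semigroup]
  have h3 := ENNReal.toReal_mono ENNReal.ofReal_ne_top h2
  rwa [ENNReal.toReal_mul, ENNReal.toReal_ofReal (hg b).le,
    ENNReal.toReal_ofReal (mul_nonneg (Real.exp_nonneg _) (hg a).le)] at h3

end Lyapunov

/-! ### A criterion for the Feller property -/

section Feller

open Classical in
lemma hasSum_ite_mem {E : Type*} (s : Finset E) (F : E → ℝ) :
    HasSum (fun b => if b ∈ s then F b else 0) (∑ b ∈ s, F b) := by
  have h : HasSum (fun b => if b ∈ s then F b else 0) (∑ b ∈ s, if b ∈ s then F b else 0) :=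
    hasSum_sum_of_ne_finset_zero fun b hb => if_neg hb
  rwa [Finset.sum_congr rfl fun b hb => if_pos hb] at h

variable {E : Type*} [TopologicalSpace E] [DiscreteTopology E]

/-- A stochastic matrix whose columns tend to `0` at infinity acts on `C₀(E)`. -/
def matrixAct (P : E → E → ℝ) (hP : ∀ a b, 0 ≤ P a b) (hsum : ∀ a, HasSum (P a) 1)
    (hcol : ∀ b, Tendsto (fun a => P a b) cofinite (𝓝 0)) (f : C₀(E, ℝ)) : C₀(E, ℝ) where
  toFun a := ∑' b, P a b * f b
  continuous_toFun := continuous_of_discreteTopology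
  zero_at_infty' := by
    classical
    have hf := f.zero_at_infty'
    rw [cocompact_eq_cofinite] at hf ⊢
    rw [Metric.tendsto_nhds]
    intro ε hε
    have hfin : {b | ¬ |f b| < ε / 2}.Finite := by
      have := (Metric.tendsto_nhds.1 hf) (ε / 2) (by positivity)
      simpa [Real.dist_eq] using this
    -- Off a finite set `|f| < ε / 2`, and the row sum `1` controls that part; the finitely many
    -- remaining columns tend to `0`.
    have h1 : Tendsto (fun a => ε / 2 + ∑ c ∈ hfin.toFinset, P a c * |f c|) cofinite
        (𝓝 (ε / 2 + ∑ c ∈ hfin.toFinset, 0 * |f c|)) :=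
      tendsto_const_nhds.add (tendsto_finsetSum _ fun c _ => (hcol c).mul_const _)
    simp only [zero_mul, Finset.sum_const_zero, add_zero] at h1
    filter_upwards [h1.eventually_lt_const (half_lt_self hε)] with a ha
    rw [dist_zero_right]
    refine lt_of_le_of_lt ?_ ha
    have h2 : HasSum (fun b => P a b * (ε / 2) + if b ∈ hfin.toFinset then P a b * |f b| else 0)
        (ε / 2 + ∑ c ∈ hfin.toFinset, P a c * |f c|) := by
      refine HasSum.add (by simpa using (hsum a).mul_right (ε / 2)) ?_
      exact hasSum_ite_mem _ _
    refine tsum_of_norm_bounded h2 fun b => ?_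
    rw [norm_mul, Real.norm_of_nonneg (hP a b), Real.norm_eq_abs]
    split_ifs with hb
    · have := mul_nonneg (hP a b) hε.le
      linarith
    · rw [add_zero]
      have : |f b| < ε / 2 := by simpa using hb
      exact mul_le_mul_of_nonneg_left this.le (hP a b)

lemma hasSum_matrixAct (P : E → E → ℝ) (hP : ∀ a b, 0 ≤ P a b) (hsum : ∀ a, HasSum (P a) 1)
    (hcol : ∀ b, Tendsto (fun a => P a b) cofinite (𝓝 0)) (f : C₀(E, ℝ)) (a : E) :
    HasSum (fun b => P a b * f b) (matrixAct P hP hsum hcol f a) := by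
  refine Summable.hasSum (Summable.of_norm_bounded ((hsum a).summable.mul_right ‖f‖) fun b => ?_)
  rw [norm_mul, Real.norm_of_nonneg (hP a b)]
  exact mul_le_mul_of_nonneg_left (f.toBCF.norm_coe_le_norm b) (hP a b)

/-- A semigroup of stochastic matrices with `P t a b ≤ exp(C t) g a / g b`, where `g > 0` tends to
`0` at infinity, is Feller if its entries are continuous. -/
theorem isFellerSemigroup_of_le [Countable E] {P : ℝ → E → E → ℝ} (hP : IsMarkovSemigroup P)
    (hcont : ∀ a b, ContinuousOn (fun t => P t a b) (Ici 0)) {g : E → ℝ} (hg : ∀ a, 0 < g a)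
    (hg0 : Tendsto g cofinite (𝓝 0)) {C : ℝ} (hC : 0 ≤ C)
    (hPg : ∀ t, 0 ≤ t → ∀ a b, P t a b ≤ Real.exp (C * t) * g a / g b) :
    IsFellerSemigroup P := by
  classical
  have hsmall : ∀ (K : ℝ) b, Tendsto (fun a => K * g a / g b) cofinite (𝓝 0) := fun K b => by
    simpa using (hg0.const_mul K).div_const (g b)
  have hcol : ∀ t, 0 ≤ t → ∀ b, Tendsto (fun a => P t a b) cofinite (𝓝 0) := fun t ht b =>
    tendsto_of_tendsto_of_tendsto_of_le_of_le tendsto_const_nhds (hsmall _ b)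
      (fun a => hP.nonneg t ht a b) (fun a => hPg t ht a b)
  -- Columns are continuous in `t` uniformly in the row: for times up to `s + 1` the bound by `g`
  -- makes all but finitely many rows smaller than `ε`, and the others are handled entrywise.
  have hunif : ∀ s, 0 ≤ s → ∀ b, ∀ ε > 0, ∀ᶠ t in 𝓝[Ici 0] s, ∀ a, |P t a b - P s a b| < ε := by
    intro s hs b ε hε
    have hfin : {a | ¬ Real.exp (C * (s + 1)) * g a / g b < ε}.Finite :=
      (hsmall _ b).eventually_lt_const hε
    have h1 : ∀ᶠ t in 𝓝[Ici 0] s, ∀ a ∈ hfin.toFinset, |P t a b - P s a b| < ε := by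
      rw [eventually_all_finset]
      intro a _
      have := Metric.tendsto_nhds.1 (hcont a b s hs) ε hε
      simpa only [Real.dist_eq] using this
    have h2 : ∀ᶠ t in 𝓝[Ici 0] s, t < s + 1 :=
      nhdsWithin_le_nhds (Iio_mem_nhds (by linarith))
    filter_upwards [h1, h2, self_mem_nhdsWithin] with t ht1 ht2 ht0 a
    by_cases ha : a ∈ hfin.toFinset
    · exact ht1 a ha
    · have ha' : Real.exp (C * (s + 1)) * g a / g b < ε := by simpa using ha
      have hle : ∀ r, 0 ≤ r → r ≤ s + 1 → P r a b < ε := fun r hr0 hr =>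
        ((hPg r hr0 a b).trans (by
          have := hg a
          have := hg b
          gcongr)).trans_lt ha'
      rw [abs_sub_lt_iff]
      have := hle t ht0 ht2.le
      have := hle s hs (by linarith)
      have := hP.nonneg t ht0 a b
      have := hP.nonneg s hs a b
      constructor <;> linarith
  refine ⟨hP, fun t f => if ht : 0 ≤ t then
    matrixAct (P t) (hP.nonneg t ht) (hP.stochastic t ht) (hcol t ht) f else 0, ?_, ?_⟩
  · intro t ht f a
    beta_reduce
    rw [dif_pos ht]
    exact hasSum_matrixAct _ _ _ _ f a
  · intro f s hs
    have hs' : 0 ≤ s := hs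
    rw [ContinuousWithinAt, Metric.tendsto_nhds]
    intro ε hε
    have hfin : {b | ¬ |f b| < ε / 6}.Finite := by
      have hf := f.zero_at_infty'
      rw [cocompact_eq_cofinite] at hf
      have := (Metric.tendsto_nhds.1 hf) (ε / 6) (by positivity)
      simpa [Real.dist_eq] using this
    set F := hfin.toFinset with hF
    -- The part off `F` contributes at most `2 * (ε / 6)`, as both row sums are `1`, and the part on
    -- `F` at most `ε / 3`. The summand `1` keeps `M` positive when `F` is empty.
    set M : ℝ := ∑ b ∈ F, |f b| + 1 with hM
    have hM0 : 0 < M := by positivity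
    have h1 : ∀ᶠ t in 𝓝[Ici 0] s, ∀ b ∈ F, ∀ a, |P t a b - P s a b| < ε / (3 * M) := by
      rw [eventually_all_finset]
      exact fun b _ => hunif s hs' b _ (by positivity)
    filter_upwards [h1, self_mem_nhdsWithin] with t ht1 ht
    have ht' : 0 ≤ t := ht
    rw [dif_pos ht', dif_pos hs']
    refine lt_of_le_of_lt (b := 2 * ε / 3) ?_ (by linarith)
    rw [← ZeroAtInftyContinuousMap.dist_toBCF_eq_dist,
      BoundedContinuousFunction.dist_le (by positivity)]
    intro a
    rw [Real.dist_eq]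
    have h2 := (hasSum_matrixAct (P t) (hP.nonneg t ht) (hP.stochastic t ht) (hcol t ht) f a).sub
      (hasSum_matrixAct (P s) (hP.nonneg s hs) (hP.stochastic s hs) (hcol s hs) f a)
    have h3 : HasSum (fun b => (P t a b + P s a b) * (ε / 6) +
        if b ∈ F then |P t a b - P s a b| * |f b| else 0)
        ((1 + 1) * (ε / 6) + ∑ b ∈ F, |P t a b - P s a b| * |f b|) := by
      refine HasSum.add (((hP.stochastic t ht' a).add (hP.stochastic s hs' a)).mul_right _) ?_
      exact hasSum_ite_mem _ _
    have h4 : ∑ b ∈ F, |P t a b - P s a b| * |f b| ≤ ε / 3 := by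
      calc _ ≤ ∑ b ∈ F, ε / (3 * M) * |f b| := Finset.sum_le_sum fun b hb =>
            mul_le_mul_of_nonneg_right (ht1 b hb a).le (abs_nonneg _)
        _ = ε / (3 * M) * (M - 1) := by rw [← Finset.mul_sum, hM, add_sub_cancel_right]
        _ ≤ ε / (3 * M) * M := by gcongr; linarith
        _ = ε / 3 := by field_simp
    have h5 := tsum_of_norm_bounded h3 (f := fun b => P t a b * f b - P s a b * f b) fun b => by
      have ht0 := hP.nonneg t ht' a b
      have hs0 := hP.nonneg s hs' a b
      rw [← sub_mul, norm_mul, Real.norm_eq_abs, Real.norm_eq_abs]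
      split_ifs with hb
      · have := mul_nonneg (add_nonneg ht0 hs0) hε.le
        linarith
      · have hb' : |f b| < ε / 6 := by simpa [hF] using hb
        rw [add_zero]
        refine mul_le_mul ?_ hb'.le (abs_nonneg _) (add_nonneg ht0 hs0)
        rw [abs_le]
        constructor <;> linarith
    rw [h2.tsum_eq] at h5
    exact h5.trans (by linarith)

end Feller

/-! ### From a bound on `Q f` to a bound on `Q (1 / f)` -/

section Reciprocal

variable {E : Type*} {Q : E → E → ℝ} {S : E → Finset E}

/-- A bound on `Q (1 / f)` in terms of `Q f`, the total jump rates and the sizes of the jumps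
of `f`. -/
lemma sum_mul_inv_le (hQ : IsRateMatrix Q) (hS : ∀ a, ∀ b ∉ S a, Q a b = 0)
    (hself : ∀ a, a ∈ S a) {f : E → ℝ} (hf : ∀ a, 0 < f a) {C₁ C₂ C₃ : ℝ} (h₃ : 0 ≤ C₃)
    (hQf : ∀ a, -(C₁ * f a) ≤ ∑ b ∈ S a, Q a b * f b)
    (hdiag : ∀ a, -Q a a ≤ C₂ * f a)
    (hjump : ∀ a b, Q a b ≠ 0 → (f b - f a) ^ 2 ≤ C₃ * f b) (a : E) :
    ∑ b ∈ S a, Q a b * (f b)⁻¹ ≤ (C₁ + C₂ * C₃) * (f a)⁻¹ := by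
  classical
  have hsum := hQ.sum_eq_zero hS a
  have ha := hf a
  -- Exact second-order expansion `1/y = 2/x - y/x² + (y - x)²/(x² y)`. The first term dies by the
  -- zero row sum, the second is controlled by the lower bound on `Q f`, the third by the jump sizes
  -- and total rate.
  have h1 : ∀ b, Q a b * (f b)⁻¹ = Q a b * (2 * (f a)⁻¹) - Q a b * f b * ((f a)⁻¹) ^ 2 +
      Q a b * ((f b - f a) ^ 2 * ((f a)⁻¹ ^ 2 * (f b)⁻¹)) := fun b => by
    have := hf b
    field_simp
    ring
  have h2 : ∑ b ∈ S a, Q a b * ((f b - f a) ^ 2 * ((f a)⁻¹ ^ 2 * (f b)⁻¹)) ≤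
      C₂ * f a * (C₃ * (f a)⁻¹ ^ 2) := by
    calc _ = ∑ b ∈ (S a).erase a, Q a b * ((f b - f a) ^ 2 * ((f a)⁻¹ ^ 2 * (f b)⁻¹)) := by
          rw [sum_erase_eq hself]
          simp
      _ ≤ ∑ b ∈ (S a).erase a, Q a b * (C₃ * (f a)⁻¹ ^ 2) := by
          refine Finset.sum_le_sum fun b hb => ?_
          have hb0 := hQ.offDiag_nonneg a b (Finset.ne_of_mem_erase hb).symm
          rcases hb0.eq_or_lt with h | h
          · simp [← h]
          · refine mul_le_mul_of_nonneg_left ?_ hb0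
            have hfb := hf b
            calc _ ≤ C₃ * f b * ((f a)⁻¹ ^ 2 * (f b)⁻¹) := by
                  gcongr
                  exact hjump a b h.ne'
              _ = _ := by field_simp
      _ = -Q a a * (C₃ * (f a)⁻¹ ^ 2) := by
          rw [sum_erase_eq hself, ← Finset.sum_mul, hsum]
          ring
      _ ≤ _ := by
          gcongr
          exact hdiag a
  rw [Finset.sum_congr rfl fun b _ => h1 b, Finset.sum_add_distrib, Finset.sum_sub_distrib,
    ← Finset.sum_mul, ← Finset.sum_mul, hsum, zero_mul, zero_sub]
  have h3 : -(∑ b ∈ S a, Q a b * f b) * (f a)⁻¹ ^ 2 ≤ C₁ * f a * (f a)⁻¹ ^ 2 := by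
    gcongr
    linarith [hQf a]
  have h4 : C₁ * f a * (f a)⁻¹ ^ 2 + C₂ * f a * (C₃ * (f a)⁻¹ ^ 2) =
      (C₁ + C₂ * C₃) * (f a)⁻¹ := by
    field_simp
  linarith

end Reciprocal

/-! ### The one-dimensional birth and death rates -/

section BirthDeath

variable {u u' v v' : ℂ}

lemma birthRate_eq (u u' : ℂ) (x : ℤ) :
    birthRate u u' x = (x : ℝ) ^ 2 - (u + u').re * x + (u * u').re := by
  simp [birthRate]
  ring

lemma deathRate_eq (v v' : ℂ) (x : ℤ) :
    deathRate v v' x = (x : ℝ) ^ 2 + (v + v').re * x + (v * v').re := by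
  simp [deathRate]
  ring

lemma Admissible.birthRate_pos (h : Admissible u u' v v') (x : ℤ) : 0 < birthRate u u' x := by
  obtain ⟨r, hr, he⟩ := h.pos_u (-x)
  have h1 : ((x : ℂ) - u) * ((x : ℂ) - u') = r := by
    rw [← he]
    push_cast
    ring
  rw [birthRate, h1]
  exact hr

lemma Admissible.deathRate_pos (h : Admissible u u' v v') (x : ℤ) : 0 < deathRate v v' x := by
  obtain ⟨r, hr, he⟩ := h.pos_v x
  have h1 : ((x : ℂ) + v) * ((x : ℂ) + v') = r := by
    rw [← he]
    ring
  rw [deathRate, h1]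
  exact hr

/-- The integers at distance at most `1` from `x`. -/
def near (x : ℤ) : Finset ℤ := {x - 1, x, x + 1}

lemma mem_near {x y : ℤ} : y ∈ near x ↔ y = x - 1 ∨ y = x ∨ y = x + 1 := by
  simp [near]

lemma self_mem_near (x : ℤ) : x ∈ near x := by simp [near]

lemma rateOne_eq_zero_of_notMem_near {x y : ℤ} (h : y ∉ near x) : rateOne u u' v v' x y = 0 := by
  rw [mem_near] at h
  push Not at h
  simp [rateOne, h]

lemma rateOne_self (x : ℤ) :
    rateOne u u' v v' x x = -birthRate u u' x - deathRate v v' x := by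
  rw [rateOne, if_neg (by omega), if_neg (by omega), if_pos rfl]

lemma sum_near_rateOne (x : ℤ) (f : ℤ → ℝ) : ∑ y ∈ near x, rateOne u u' v v' x y * f y =
    birthRate u u' x * (f (x + 1) - f x) + deathRate v v' x * (f (x - 1) - f x) := by
  have h1 : x - 1 ≠ x + 1 := by omega
  rw [near, Finset.sum_insert (by simp; omega), Finset.sum_insert (by simp), Finset.sum_singleton,
    rateOne_self, rateOne, if_neg h1, if_pos rfl, rateOne, if_pos rfl]
  ring

lemma Admissible.rateOne_nonneg (h : Admissible u u' v v') {x y : ℤ} (hxy : x ≠ y) :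
    0 ≤ rateOne u u' v v' x y := by
  unfold rateOne
  split_ifs with h1 h2 h3
  · exact (h.birthRate_pos x).le
  · exact (h.deathRate_pos x).le
  · exact absurd h3.symm hxy
  · exact le_rfl

lemma Admissible.isRateMatrix_rateOne (h : Admissible u u' v v') :
    IsRateMatrix (rateOne u u' v v') :=
  isRateMatrix_of_sum_eq_zero (fun _ _ => h.rateOne_nonneg)
    (fun _ _ => rateOne_eq_zero_of_notMem_near) fun x => by
      simpa using sum_near_rateOne (u := u) (u' := u') (v := v) (v' := v') x fun _ => 1

end BirthDeath

/-! ### Signatures as strictly ordered particle configurations -/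

section Signatures

variable {N : ℕ}

lemma coord_strictAnti (lam : Signature N) : StrictAnti (coord lam) := by
  intro i j hij
  have h1 := lam.2 hij.le
  have h2 : (i : ℤ) < (j : ℤ) := by exact_mod_cast hij
  simp only [coord]
  omega

lemma coord_injective : Function.Injective (coord : Signature N → Fin N → ℤ) := by
  intro lam nu h
  ext i
  have := congrFun h i
  simp only [coord] at this
  omega

lemma exists_coord_eq {n : Fin N → ℤ} (hn : StrictAnti n) : ∃ lam : Signature N, coord lam = n := by
  refine ⟨⟨fun i => n i - N + (i + 1), ?_⟩, ?_⟩
  · cases N with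
    | zero => exact fun i => i.elim0
    | succ m =>
      rw [Fin.antitone_iff_succ_le]
      intro i
      have := hn (Fin.castSucc_lt_succ (i := i))
      simp only [Fin.val_succ, Fin.val_castSucc]
      push_cast
      omega
  · funext i
    simp only [coord]
    ring

/-- The Vandermonde determinant in the coordinates of a signature. -/
def vdm (l : Fin N → ℤ) : ℝ := (Matrix.vandermonde fun i => (l i : ℝ)).det

/-- The constant ratio between `dim` and the Vandermonde determinant. -/
def dimScale (N : ℕ) : ℝ :=
  (∏ i : Fin N, ∏ _j ∈ Finset.Ioi i, (-1 : ℝ)) / ∏ i ∈ Finset.range N, (i ! : ℝ)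

lemma dim_eq (lam : Signature N) : dim lam = dimScale N * vdm (coord lam) := by
  rw [dim, dimScale, vdm, Matrix.det_vandermonde, div_mul_eq_mul_div, ← Finset.prod_mul_distrib]
  congr 1
  refine Finset.prod_congr rfl fun i _ => ?_
  rw [← Finset.prod_mul_distrib]
  refine Finset.prod_congr rfl fun j _ => ?_
  simp only [coord]
  push_cast
  ring

/-- Every factor of the numerator is at least `1`. Uniformity in `lam` keeps `dim nu / dim lam`
bounded, as the uniqueness argument requires. -/
lemma inv_le_dim (lam : Signature N) : (∏ i ∈ Finset.range N, (i ! : ℝ))⁻¹ ≤ dim lam := by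
  have h0 : (0 : ℝ) < ∏ i ∈ Finset.range N, (i ! : ℝ) :=
    Finset.prod_pos fun i _ => by exact_mod_cast Nat.factorial_pos i
  rw [dim, ← one_div]
  refine div_le_div_of_nonneg_right ?_ h0.le
  have h1 : ∀ i : Fin N, ∀ j ∈ Finset.Ioi i,
      (1 : ℝ) ≤ (lam.1 i : ℝ) - ((i : ℕ) : ℝ) - (lam.1 j : ℝ) + ((j : ℕ) : ℝ) := by
    intro i j hj
    have hij := Finset.mem_Ioi.1 hj
    have h2 : (lam.1 j : ℝ) ≤ lam.1 i := by exact_mod_cast lam.2 hij.le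
    have h3 : ((i : ℕ) : ℝ) + 1 ≤ ((j : ℕ) : ℝ) := by exact_mod_cast hij
    linarith
  have h2 : ∀ (s : Finset (Fin N)) (f : Fin N → ℝ), (∀ i ∈ s, 1 ≤ f i) → 1 ≤ ∏ i ∈ s, f i :=
    fun s f hf => by
      calc (1 : ℝ) = ∏ i ∈ s, 1 := by simp
        _ ≤ _ := Finset.prod_le_prod (fun _ _ => zero_le_one) hf
  exact h2 _ _ fun i _ => h2 _ _ (h1 i)

lemma dim_pos (lam : Signature N) : 0 < dim lam :=
  lt_of_lt_of_le (inv_pos.2 (Finset.prod_pos fun i _ => by exact_mod_cast Nat.factorial_pos i))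
    (inv_le_dim lam)

lemma vdm_coord_ne_zero (lam : Signature N) : vdm (coord lam) ≠ 0 :=
  right_ne_zero_of_mul (dim_eq lam ▸ (dim_pos lam).ne')

lemma dimScale_ne_zero (lam : Signature N) : dimScale N ≠ 0 :=
  left_ne_zero_of_mul (dim_eq lam ▸ (dim_pos lam).ne')

/-- A particle moving by at most one cannot overtake a neighbour without first occupying the same
site. -/
lemma strictAnti_update_of_near {l : Fin N → ℤ} (hl : StrictAnti l) {i : Fin N} {y : ℤ}
    (hy : y ∈ near (l i)) (hinj : Function.Injective (Function.update l i y)) :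
    StrictAnti (Function.update l i y) := by
  intro j k hjk
  refine lt_of_le_of_ne ?_ (hinj.ne hjk.ne').symm.symm
  have h1 := hl hjk
  rw [mem_near] at hy
  by_cases hj : j = i
  · subst hj
    rw [Function.update_self, Function.update_of_ne hjk.ne']
    omega
  · rw [Function.update_of_ne hj]
    by_cases hk : k = i
    · subst hk
      rw [Function.update_self]
      omega
    · rw [Function.update_of_ne hk]
      exact h1.le

/-- The signatures that differ from `lam` by at most `1` in at most one coordinate. -/
def nbrs (lam : Signature N) : Finset (Signature N) :=
  (Finset.univ.biUnion fun i => (near (coord lam i)).image (Function.update (coord lam) i)).preimage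
    coord coord_injective.injOn

lemma mem_nbrs {lam nu : Signature N} : nu ∈ nbrs lam ↔
    ∃ i, ∃ y ∈ near (coord lam i), Function.update (coord lam) i y = coord nu := by
  simp [nbrs]

lemma self_mem_nbrs (hN : 1 ≤ N) (lam : Signature N) : lam ∈ nbrs lam :=
  mem_nbrs.2 ⟨⟨0, hN⟩, _, self_mem_near _, Function.update_eq_self _ _⟩

variable {u u' v v' : ℂ}

lemma update_coord_eq {l n : Fin N → ℤ} {i : Fin N} (h : ∀ j, j ≠ i → l j = n j) :
    Function.update l i (n i) = n := by
  funext j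
  by_cases hj : j = i
  · subst hj
    simp
  · rw [Function.update_of_ne hj, h j hj]

/-- The sum of the one-dimensional generators acting on the coordinates. -/
def gen (u u' v v' : ℂ) (F : (Fin N → ℤ) → ℝ) (l : Fin N → ℤ) : ℝ :=
  ∑ i, ∑ y ∈ near (l i), rateOne u u' v v' (l i) y * F (Function.update l i y)

-- The moves missing on the left are those leading to a collision, and there `F` vanishes; hence the
-- constrained sum may be taken over all moves in `ℤ^N`. Staying put is counted once for each `i` on
-- both sides.
open Classical in
lemma sum_nbrs_rateOne (F : (Fin N → ℤ) → ℝ) (hF : ∀ l, ¬ Function.Injective l → F l = 0)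
    (lam : Signature N) :
    ∑ nu ∈ nbrs lam, (∑ i : Fin N, rateOne u u' v v' (coord lam i) (coord nu i) *
      (if ∀ j : Fin N, j ≠ i → coord lam j = coord nu j then 1 else 0)) * F (coord nu) =
      gen u u' v v' F (coord lam) := by
  simp_rw [Finset.sum_mul]
  rw [Finset.sum_comm, gen]
  refine Finset.sum_congr rfl fun i _ => ?_
  refine Finset.sum_bij_ne_zero (fun nu _ _ => coord nu i) ?_ ?_ ?_ ?_
  · intro nu _ h
    by_contra hy
    simp [rateOne_eq_zero_of_notMem_near hy] at h
  · intro nu₁ _ h₁ nu₂ _ h₂ heq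
    have h₁' : ∀ j, j ≠ i → coord lam j = coord nu₁ j := by
      by_contra hc
      rw [if_neg hc] at h₁
      simp at h₁
    have h₂' : ∀ j, j ≠ i → coord lam j = coord nu₂ j := by
      by_contra hc
      rw [if_neg hc] at h₂
      simp at h₂
    apply coord_injective
    rw [← update_coord_eq h₁', ← update_coord_eq h₂']
    exact congrArg _ heq
  · intro y hy hne
    have hinj : Function.Injective (Function.update (coord lam) i y) := by
      by_contra hc
      rw [hF _ hc] at hne
      simp at hne
    obtain ⟨nu, hnu⟩ := exists_coord_eq (strictAnti_update_of_near (coord_strictAnti lam) hy hinj)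
    have h1 : coord nu i = y := by rw [hnu, Function.update_self]
    have h2 : ∀ j, j ≠ i → coord lam j = coord nu j := fun j hj => by
      rw [hnu, Function.update_of_ne hj]
    refine ⟨nu, mem_nbrs.2 ⟨i, y, hy, hnu.symm⟩, ?_, h1⟩
    rw [if_pos h2, h1, hnu, mul_one]
    exact hne
  · intro nu _ h
    have h' : ∀ j, j ≠ i → coord lam j = coord nu j := by
      by_contra hc
      rw [if_neg hc] at h
      simp at h
    rw [if_pos h', update_coord_eq h', mul_one]

lemma rateN_eq_zero_of_notMem_nbrs (hN : 1 ≤ N) {lam nu : Signature N} (h : nu ∉ nbrs lam) :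
    rateN u u' v v' N lam nu = 0 := by
  classical
  have hne : lam ≠ nu := fun h' => h (h' ▸ self_mem_nbrs hN lam)
  rw [rateN, if_neg hne, mul_zero, sub_zero, Finset.sum_eq_zero, mul_zero]
  intro i _
  by_cases hy : coord nu i ∈ near (coord lam i)
  · rw [if_neg, mul_zero]
    exact fun h' => h (mem_nbrs.2 ⟨i, _, hy, update_coord_eq h'⟩)
  · rw [rateOne_eq_zero_of_notMem_near hy, zero_mul]

/-- The matrix `rateN` is the Doob transform of the generator `gen`. -/
lemma sum_nbrs_rateN (hN : 1 ≤ N) (F : (Fin N → ℤ) → ℝ)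
    (hF : ∀ l, ¬ Function.Injective l → F l = 0) {g : Signature N → ℝ}
    (hg : ∀ nu, dim nu * g nu = F (coord nu)) (lam : Signature N) :
    ∑ nu ∈ nbrs lam, rateN u u' v v' N lam nu * g nu =
      (dim lam)⁻¹ * gen u u' v v' F (coord lam) - dConst u u' v v' N * g lam := by
  classical
  rw [← sum_nbrs_rateOne F hF, Finset.mul_sum]
  have h1 : dConst u u' v v' N * g lam =
      ∑ nu ∈ nbrs lam, dConst u u' v v' N * (if lam = nu then 1 else 0) * g nu := by
    simp [self_mem_nbrs hN lam]
  rw [h1, ← Finset.sum_sub_distrib]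
  refine Finset.sum_congr rfl fun nu _ => ?_
  rw [rateN, ← hg, sub_mul]
  congr 1
  ring

lemma Admissible.rateN_nonneg (h : Admissible u u' v v') {lam nu : Signature N} (hne : lam ≠ nu) :
    0 ≤ rateN u u' v v' N lam nu := by
  classical
  rw [rateN, if_neg hne, mul_zero, sub_zero]
  refine mul_nonneg (div_pos (dim_pos nu) (dim_pos lam)).le (Finset.sum_nonneg fun i _ => ?_)
  split_ifs with h'
  · rw [mul_one]
    refine h.rateOne_nonneg fun heq => hne (coord_injective ?_)
    rw [← update_coord_eq h', ← heq, Function.update_eq_self]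
  · rw [mul_zero]

lemma rateN_self (lam : Signature N) : rateN u u' v v' N lam lam =
    ∑ i, (-birthRate u u' (coord lam i) - deathRate v v' (coord lam i)) -
      dConst u u' v v' N := by
  classical
  simp [rateN, rateOne_self, (dim_pos lam).ne']

end Signatures

/-! ### The generator on determinants of polynomials -/

section Determinants

/-- Cofactor expansion turns the left side into `tr (adj A * B)`, and `adj A * A = det A • 1`;
expanding `tr (adj A * R)` by columns gives the last sum. -/
lemma sum_det_updateRow {n : Type*} [Fintype n] [DecidableEq n] {A B M R : Matrix n n ℝ}
    (hB : B = A * M + R) : ∑ i, (A.updateRow i (B i)).det =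
      A.det * M.trace + ∑ j, (A.updateCol j fun i => R i j).det := by
  have h1 : ∀ i, (A.updateRow i (B i)).det = ∑ j, A.adjugate j i * B i j := fun i => by
    rw [← Matrix.cramer_transpose_apply, Matrix.cramer_eq_adjugate_mulVec,
      ← Matrix.adjugate_transpose]
    rfl
  have h2 : ∀ j, (A.updateCol j fun i => R i j).det = (A.adjugate * R) j j := fun j => by
    rw [← Matrix.cramer_apply, Matrix.cramer_eq_adjugate_mulVec]
    rfl
  have h3 : ∑ i, ∑ j, A.adjugate j i * B i j = (A.adjugate * B).trace := by
    rw [Finset.sum_comm]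
    rfl
  simp_rw [h1, h2]
  rw [h3, hB, mul_add, ← mul_assoc, Matrix.adjugate_mul, Matrix.trace_add, smul_mul_assoc, one_mul,
    Matrix.trace_smul, smul_eq_mul]
  rfl

variable {u u' v v' : ℂ}

/-- Moving particle `i` alters row `i` only, and the determinant is linear in that row. -/
lemma gen_det {N : ℕ} (ph : Fin N → ℤ → ℝ) (l : Fin N → ℤ) :
    gen u u' v v' (fun l => (Matrix.of fun i j => ph j (l i)).det) l =
      ∑ i, ((Matrix.of fun i j => ph j (l i)).updateRow i
        fun j => ∑ y ∈ near (l i), rateOne u u' v v' (l i) y * ph j y).det := by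
  refine Finset.sum_congr rfl fun i _ => ?_
  set A : Matrix (Fin N) (Fin N) ℝ := Matrix.of fun i j => ph j (l i) with hA
  have h1 : ∀ y, (Matrix.of fun k j => ph j (Function.update l i y k)).det =
      A.transpose.cramer (fun j => ph j y) i := fun y => by
    rw [Matrix.cramer_transpose_apply]
    congr 1
    ext k j
    by_cases hk : k = i
    · subst hk
      simp
    · simp [hk, hA]
  have h2 : (fun j => ∑ y ∈ near (l i), rateOne u u' v v' (l i) y * ph j y) =
      ∑ y ∈ near (l i), rateOne u u' v v' (l i) y • fun j => ph j y := by
    ext j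
    simp
  rw [← Matrix.cramer_transpose_apply, h2, map_sum, Finset.sum_apply]
  refine Finset.sum_congr rfl fun y _ => ?_
  beta_reduce
  rw [h1, map_smul, Pi.smul_apply, smul_eq_mul]

open Polynomial

/-- The birth and death generator on polynomials. -/
def polyGen (u u' v v' : ℂ) (p : ℝ[X]) : ℝ[X] :=
  (X ^ 2 - C (u + u').re * X + C (u * u').re) * (p.comp (X + 1) - p) +
    (X ^ 2 + C (v + v').re * X + C (v * v').re) * (p.comp (X - 1) - p)

lemma eval_polyGen (p : ℝ[X]) (x : ℤ) : (polyGen u u' v v' p).eval (x : ℝ) =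
    ∑ y ∈ near x, rateOne u u' v v' x y * p.eval (y : ℝ) := by
  rw [sum_near_rateOne x fun y : ℤ => p.eval (y : ℝ), birthRate_eq, deathRate_eq]
  simp [polyGen]

lemma polyGen_add (p q : ℝ[X]) :
    polyGen u u' v v' (p + q) = polyGen u u' v v' p + polyGen u u' v v' q := by
  simp only [polyGen, add_comp]
  ring

/-- The eigenvalues of the birth and death generator on polynomials. -/
def eigen (u u' v v' : ℂ) (k : ℕ) : ℝ := (k : ℝ) * (k - 1) - (u + u' + v + v').re * k

lemma X_mul_mem_degreeLT {r : ℝ[X]} {k : ℕ} (hr : r ∈ degreeLT ℝ k) :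
    X * r ∈ degreeLT ℝ (k + 1) := by
  rw [mem_degreeLT] at hr ⊢
  rw [mul_comm, degree_mul_X]
  push_cast
  exact WithBot.add_lt_add_right (by simp) hr

lemma X_pow_mem_degreeLT {j k : ℕ} (h : j < k) : (X ^ j : ℝ[X]) ∈ degreeLT ℝ k := by
  rw [mem_degreeLT, degree_X_pow]
  exact_mod_cast h

lemma C_mul_mem_degreeLT {r : ℝ[X]} {k : ℕ} (c : ℝ) (hr : r ∈ degreeLT ℝ k) :
    C c * r ∈ degreeLT ℝ k := by
  rw [← smul_eq_C_mul]
  exact Submodule.smul_mem _ _ hr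

lemma pow_sub_pow_mem_degreeLT (c : ℝ) (k : ℕ) :
    (X + C c) ^ k - X ^ k ∈ degreeLT ℝ k := by
  induction k with
  | zero => simp
  | succ k ih =>
    have h1 : (X + C c) ^ (k + 1) - X ^ (k + 1) =
        X * ((X + C c) ^ k - X ^ k) + C c * ((X + C c) ^ k - X ^ k) + C c * X ^ k := by ring
    rw [h1]
    exact add_mem (add_mem (X_mul_mem_degreeLT ih)
      (C_mul_mem_degreeLT c (degreeLT_mono k.le_succ ih)))
      (C_mul_mem_degreeLT c (X_pow_mem_degreeLT k.lt_succ_self))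

lemma X_mul_pow_sub_pow_mem_degreeLT (c : ℝ) (k : ℕ) :
    X * ((X + C c) ^ k - X ^ k) - C (c * k) * X ^ k ∈ degreeLT ℝ k := by
  induction k with
  | zero => simp
  | succ k ih =>
    have h1 : X * ((X + C c) ^ (k + 1) - X ^ (k + 1)) - C (c * (k + 1 : ℕ)) * X ^ (k + 1) =
        X * (X * ((X + C c) ^ k - X ^ k) - C (c * k) * X ^ k) +
          C c * (X * ((X + C c) ^ k - X ^ k) - C (c * k) * X ^ k) +
          C (c * (c * k)) * X ^ k := by
      push_cast
      simp only [C_mul, C_add, C_1]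
      ring
    rw [h1]
    exact add_mem (add_mem (X_mul_mem_degreeLT ih)
      (C_mul_mem_degreeLT c (degreeLT_mono k.le_succ ih)))
      (C_mul_mem_degreeLT _ (X_pow_mem_degreeLT k.lt_succ_self))

/-- Binomial expansion of the shift by `c`, kept down to degree `k`; the induction multiplies by `X
+ C c`. -/
lemma X_sq_mul_pow_sub_pow_mem_degreeLT (c : ℝ) (k : ℕ) :
    X ^ 2 * ((X + C c) ^ k - X ^ k) - C (c * k) * X ^ (k + 1) -
      C (c ^ 2 * (k * (k - 1) / 2)) * X ^ k ∈ degreeLT ℝ k := by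
  induction k with
  | zero => simp
  | succ k ih =>
    have h1 : X ^ 2 * ((X + C c) ^ (k + 1) - X ^ (k + 1)) -
        C (c * (k + 1 : ℕ)) * X ^ (k + 1 + 1) -
        C (c ^ 2 * ((k + 1 : ℕ) * ((k + 1 : ℕ) - 1) / 2)) * X ^ (k + 1) =
        X * (X ^ 2 * ((X + C c) ^ k - X ^ k) - C (c * k) * X ^ (k + 1) -
          C (c ^ 2 * (k * (k - 1) / 2)) * X ^ k) +
        C c * (X ^ 2 * ((X + C c) ^ k - X ^ k) - C (c * k) * X ^ (k + 1) -
          C (c ^ 2 * (k * (k - 1) / 2)) * X ^ k) +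
        C (c * (c ^ 2 * (k * (k - 1) / 2))) * X ^ k := by
      have h2 : c ^ 2 * ((k + 1 : ℕ) * ((k + 1 : ℕ) - 1) / 2) =
          c ^ 2 * (k * (k - 1) / 2) + c * (c * k) := by
        push_cast
        ring
      rw [h2]
      push_cast
      simp only [C_mul, C_add, C_1, C_pow]
      ring
    rw [h1]
    exact add_mem (add_mem (X_mul_mem_degreeLT ih)
      (C_mul_mem_degreeLT c (degreeLT_mono k.le_succ ih)))
      (C_mul_mem_degreeLT _ (X_pow_mem_degreeLT k.lt_succ_self))

/-- Both rates have leading term `x ^ 2`, so the contributions `± k * X ^ (k + 1)` of births and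
deaths cancel. In degree `k` the second differences add up to `k * (k - 1)`, and the linear terms of
the rates give the rest of `eigen`. -/
lemma polyGen_X_pow (k : ℕ) :
    polyGen u u' v v' (X ^ k) - C (eigen u u' v v' k) * X ^ k ∈ degreeLT ℝ k := by
  have h1 : polyGen u u' v v' (X ^ k) - C (eigen u u' v v' k) * X ^ k =
      (X ^ 2 * ((X + C 1) ^ k - X ^ k) - C (1 * (k : ℝ)) * X ^ (k + 1) -
        C (1 ^ 2 * ((k : ℝ) * (k - 1) / 2)) * X ^ k) +
      (X ^ 2 * ((X + C (-1)) ^ k - X ^ k) - C (-1 * (k : ℝ)) * X ^ (k + 1) -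
        C ((-1) ^ 2 * ((k : ℝ) * (k - 1) / 2)) * X ^ k) -
      C (u + u').re * (X * ((X + C 1) ^ k - X ^ k) - C (1 * (k : ℝ)) * X ^ k) +
      C (v + v').re * (X * ((X + C (-1)) ^ k - X ^ k) - C (-1 * (k : ℝ)) * X ^ k) +
      C (u * u').re * ((X + C 1) ^ k - X ^ k) +
      C (v * v').re * ((X + C (-1)) ^ k - X ^ k) := by
    have h2 : eigen u u' v v' k = 2 * ((k : ℝ) * (k - 1) / 2) - (u + u').re * k - (v + v').re * k := by
      simp only [eigen, Complex.add_re]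
      ring
    simp only [polyGen, h2, X_pow_comp, C_neg, C_1, ← sub_eq_add_neg, one_mul, one_pow, neg_mul,
      even_two, Even.neg_pow, C_sub, C_mul]
    have h3 : (C (2 : ℝ)) = 2 := rfl
    rw [h3]
    ring
  rw [h1]
  have a1 := X_sq_mul_pow_sub_pow_mem_degreeLT 1 k
  have a2 := X_sq_mul_pow_sub_pow_mem_degreeLT (-1) k
  have b1 := C_mul_mem_degreeLT (u + u').re (X_mul_pow_sub_pow_mem_degreeLT 1 k)
  have b2 := C_mul_mem_degreeLT (v + v').re (X_mul_pow_sub_pow_mem_degreeLT (-1) k)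
  have c1 := C_mul_mem_degreeLT (u * u').re (pow_sub_pow_mem_degreeLT 1 k)
  have c2 := C_mul_mem_degreeLT (v * v').re (pow_sub_pow_mem_degreeLT (-1) k)
  exact add_mem (add_mem (add_mem (sub_mem (add_mem a1 a2) b1) b2) c1) c2

lemma sum_eigen (n : ℕ) : ∑ k ∈ Finset.range n, eigen u u' v v' k = dConst u u' v v' n := by
  induction n with
  | zero => simp [dConst]
  | succ n ih =>
    rw [Finset.sum_range_succ, ih, dConst, dConst, eigen]
    push_cast
    ring

variable {m : ℕ}

/-- The Vandermonde determinant with the last column replaced by the values of `p`. -/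
def altDet (x : Fin (m + 1) → ℝ) (p : ℝ[X]) : ℝ :=
  ((Matrix.vandermonde x).updateCol (Fin.last m) fun i => p.eval (x i)).det

lemma altDet_add (x : Fin (m + 1) → ℝ) (p q : ℝ[X]) :
    altDet x (p + q) = altDet x p + altDet x q := by
  rw [altDet, altDet, altDet, ← Matrix.det_updateCol_add]
  congr 2
  ext i
  simp

lemma altDet_C_mul (x : Fin (m + 1) → ℝ) (c : ℝ) (p : ℝ[X]) :
    altDet x (C c * p) = c * altDet x p := by
  rw [altDet, altDet, ← Matrix.det_updateCol_smul]
  congr 2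
  ext i
  simp

lemma altDet_eq_zero {x : Fin (m + 1) → ℝ} {p : ℝ[X]} (h : ∀ i, p.eval (x i) = 0) :
    altDet x p = 0 :=
  Matrix.det_eq_zero_of_column_eq_zero (Fin.last m) fun i => by simp [h]

lemma altDet_X_pow (x : Fin (m + 1) → ℝ) :
    altDet x (X ^ m) = (Matrix.vandermonde x).det := by
  rw [altDet]
  congr 1
  ext i j
  by_cases hj : j = Fin.last m
  · subst hj
    simp [Matrix.vandermonde]
  · simp [Matrix.updateCol_ne hj]

lemma altDet_X_pow_of_lt (x : Fin (m + 1) → ℝ) {k : ℕ} (hk : k < m) : altDet x (X ^ k) = 0 := by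
  have hne : (⟨k, by omega⟩ : Fin (m + 1)) ≠ Fin.last m := by
    intro h
    have := congrArg Fin.val h
    simp at this
    omega
  refine Matrix.det_zero_of_column_eq hne fun i => ?_
  rw [Matrix.updateCol_ne hne, Matrix.updateCol_self]
  simp [Matrix.vandermonde]

lemma altDet_of_mem_degreeLT (x : Fin (m + 1) → ℝ) {p : ℝ[X]} (hp : p ∈ degreeLT ℝ m) :
    altDet x p = 0 := by
  rw [mem_degreeLT] at hp
  have h1 : ∀ s : Finset ℕ, (∀ k ∈ s, k < m) → altDet x (∑ k ∈ s, C (p.coeff k) * X ^ k) = 0 := by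
    intro s
    induction s using Finset.induction_on with
    | empty => exact fun _ => altDet_eq_zero fun i => by simp
    | insert a s ha ih =>
      intro hs
      rw [Finset.sum_insert ha, altDet_add, altDet_C_mul,
        altDet_X_pow_of_lt x (hs a (Finset.mem_insert_self a s)), mul_zero, zero_add]
      exact ih fun k hk => hs k (Finset.mem_insert_of_mem hk)
  rw [p.as_sum_support_C_mul_X_pow]
  refine h1 _ fun k hk => ?_
  have := (le_degree_of_mem_supp k hk).trans_lt hp
  exact_mod_cast this

lemma altDet_of_not_injective {x : Fin (m + 1) → ℝ} (hx : ¬ Function.Injective x) (p : ℝ[X]) :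
    altDet x p = 0 := by
  obtain ⟨i, j, hij, hne⟩ : ∃ i j, x i = x j ∧ i ≠ j := by
    simpa [Function.Injective] using hx
  refine Matrix.det_zero_of_row_eq hne ?_
  ext k
  by_cases hk : k = Fin.last m
  · subst hk
    simp [hij]
  · simp [Matrix.updateCol_ne hk, hij, Matrix.vandermonde]

/-- The columns `1, …, X ^ (m - 1)` span a space on which the generator is triangular, so they
contribute only the trace of its matrix; the last column is acted on separately. -/
lemma gen_altDet (p : ℝ[X]) (l : Fin (m + 1) → ℤ) :
    gen u u' v v' (fun l => altDet (fun i => (l i : ℝ)) p) l =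
      (∑ k ∈ Finset.range m, eigen u u' v v' k) * altDet (fun i => (l i : ℝ)) p +
        altDet (fun i => (l i : ℝ)) (polyGen u u' v v' p) := by
  set ph : Fin (m + 1) → ℝ[X] := fun j => if j = Fin.last m then p else X ^ (j : ℕ) with hph
  have h1 : ∀ l : Fin (m + 1) → ℤ, altDet (fun i => (l i : ℝ)) p =
      (Matrix.of fun i j => (ph j).eval (l i : ℝ)).det := fun l => by
    rw [altDet]
    congr 1
    ext i j
    by_cases hj : j = Fin.last m
    · subst hj
      simp [hph]
    · simp [hph, hj, Matrix.vandermonde]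
  have hlt : ∀ j : Fin (m + 1), j ≠ Fin.last m → (j : ℕ) < m := fun j hj =>
    Fin.val_lt_last hj
  have hdeg : ∀ k, (polyGen u u' v v' (X ^ k)).degree < (k + 1 : ℕ) := fun k => by
    have h := add_mem (degreeLT_mono k.le_succ (polyGen_X_pow (u := u) (u' := u') (v := v)
      (v' := v') k)) (C_mul_mem_degreeLT (eigen u u' v v' k) (X_pow_mem_degreeLT k.lt_succ_self))
    rw [sub_add_cancel, mem_degreeLT] at h
    exact h
  have hcoeff : ∀ k, (polyGen u u' v v' (X ^ k)).coeff k = eigen u u' v v' k := fun k => by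
    have h := coeff_eq_zero_of_degree_lt (mem_degreeLT.1 (polyGen_X_pow (u := u) (u' := u')
      (v := v) (v' := v') k))
    rw [coeff_sub, coeff_C_mul, coeff_X_pow_self, mul_one, sub_eq_zero] at h
    exact h
  set A : Matrix (Fin (m + 1)) (Fin (m + 1)) ℝ := Matrix.of fun i j => (ph j).eval (l i : ℝ) with hA
  set B : Matrix (Fin (m + 1)) (Fin (m + 1)) ℝ :=
    Matrix.of fun i j => (polyGen u u' v v' (ph j)).eval (l i : ℝ) with hB
  -- `M` expresses the images of the first `m` columns through those same columns. The image of `p`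
  -- need not lie in the span of the columns, so it goes into `R`.
  set M : Matrix (Fin (m + 1)) (Fin (m + 1)) ℝ := Matrix.of fun k j =>
    if j = Fin.last m then 0 else (polyGen u u' v v' (X ^ (j : ℕ))).coeff k with hM
  set R : Matrix (Fin (m + 1)) (Fin (m + 1)) ℝ := Matrix.of fun i j =>
    if j = Fin.last m then (polyGen u u' v v' p).eval (l i : ℝ) else 0 with hR
  have hBA : B = A * M + R := by
    ext i j
    rw [Matrix.add_apply, Matrix.mul_apply]
    by_cases hj : j = Fin.last m
    · simp [hB, hM, hR, hph, hj]
    · have hd : (polyGen u u' v v' (X ^ (j : ℕ))).natDegree < m + 1 := by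
        refine Nat.lt_succ_of_le (natDegree_le_of_degree_le ((hdeg j).le.trans ?_))
        exact_mod_cast hlt j hj
      simp only [hB, hM, hR, hph, hA, hj, Matrix.of_apply, if_false, add_zero]
      rw [eval_eq_sum_range' hd, ← Fin.sum_univ_eq_sum_range
        (fun k => (polyGen u u' v v' (X ^ (j : ℕ))).coeff k * (l i : ℝ) ^ k)]
      refine Finset.sum_congr rfl fun k _ => ?_
      -- The last column of `A` holds `p`, not `X ^ m`, but it never enters: the image of `X ^ j`
      -- with `j < m` has no term of degree `m`.
      by_cases hk : k = Fin.last m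
      · have h0 : (polyGen u u' v v' (X ^ (j : ℕ))).coeff k = 0 := by
          refine coeff_eq_zero_of_degree_lt ((hdeg j).trans_le ?_)
          rw [hk]
          exact_mod_cast hlt j hj
        rw [h0, zero_mul, mul_zero]
      · rw [if_neg hk, eval_pow, eval_X, mul_comm]
  have htr : M.trace = ∑ k ∈ Finset.range m, eigen u u' v v' k := by
    rw [Matrix.trace, Fin.sum_univ_castSucc, ← Fin.sum_univ_eq_sum_range]
    simp [hM, Fin.castSucc_ne_last, hcoeff]
  have hR' : ∑ j, (A.updateCol j fun i => R i j).det =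
      altDet (fun i => (l i : ℝ)) (polyGen u u' v v' p) := by
    rw [Finset.sum_eq_single (Fin.last m)]
    · rw [altDet]
      congr 1
      ext i j
      by_cases hj : j = Fin.last m
      · subst hj
        simp [hR]
      · simp [hA, hph, hj, Matrix.vandermonde]
    · intro j _ hj
      refine Matrix.det_eq_zero_of_column_eq_zero j fun i => ?_
      simp [hR, hj]
    · simp
  have h2 := sum_det_updateRow hBA
  rw [htr, hR'] at h2
  rw [funext h1, gen_det fun j (x : ℤ) => (ph j).eval (x : ℝ), mul_comm, h1 l, ← h2]
  simp_rw [← eval_polyGen]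
  rfl

end Determinants

/-! ### Bialternant formulas for the complete symmetric polynomials of degree 1 and 2 -/

section SymmetricFunctions

open Polynomial

variable {m : ℕ}

lemma prod_X_sub_C_mem_degreeLT (x : Fin (m + 1) → ℝ) :
    ∏ i, (X - C (x i)) - (X ^ (m + 1) - C (∑ i, x i) * X ^ m) ∈ degreeLT ℝ m := by
  induction m with
  | zero => simp
  | succ m ih =>
    set y := x (Fin.last _)
    set z : Fin (m + 1) → ℝ := fun i => x i.castSucc
    have h1 : ∏ i, (X - C (x i)) - (X ^ (m + 1 + 1) - C (∑ i, x i) * X ^ (m + 1)) =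
        X * (∏ i, (X - C (z i)) - (X ^ (m + 1) - C (∑ i, z i) * X ^ m)) +
        C (-y) * (∏ i, (X - C (z i)) - (X ^ (m + 1) - C (∑ i, z i) * X ^ m)) +
        C (y * ∑ i, z i) * X ^ m := by
      rw [Fin.prod_univ_castSucc, Fin.sum_univ_castSucc]
      simp only [C_add, C_mul, C_neg]
      ring
    rw [h1]
    exact add_mem (add_mem (X_mul_mem_degreeLT (ih z))
      (C_mul_mem_degreeLT _ (degreeLT_mono m.le_succ (ih z))))
      (C_mul_mem_degreeLT _ (X_pow_mem_degreeLT m.lt_succ_self))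

lemma X_mul_prod_X_sub_C_mem_degreeLT (x : Fin (m + 1) → ℝ) :
    X * ∏ i, (X - C (x i)) - (X ^ (m + 2) - C (∑ i, x i) * X ^ (m + 1) +
      C (((∑ i, x i) ^ 2 - ∑ i, x i ^ 2) / 2) * X ^ m) ∈ degreeLT ℝ m := by
  induction m with
  | zero =>
    have h1 : X * ∏ i, (X - C (x i)) - (X ^ (0 + 2) - C (∑ i, x i) * X ^ (0 + 1) +
      C (((∑ i, x i) ^ 2 - ∑ i, x i ^ 2) / 2) * X ^ 0) = (0 : ℝ[X]) := by
      simp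
      ring
    rw [h1]
    exact zero_mem _
  | succ m ih =>
    set y := x (Fin.last _)
    set z : Fin (m + 1) → ℝ := fun i => x i.castSucc
    set e := ((∑ i, z i) ^ 2 - ∑ i, z i ^ 2) / 2 with he
    set r := X * ∏ i, (X - C (z i)) - (X ^ (m + 2) - C (∑ i, z i) * X ^ (m + 1) + C e * X ^ m)
      with hr
    have h1 : X * ∏ i, (X - C (x i)) - (X ^ (m + 1 + 2) - C (∑ i, x i) * X ^ (m + 1 + 1) +
        C (((∑ i, x i) ^ 2 - ∑ i, x i ^ 2) / 2) * X ^ (m + 1)) =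
        X * r + C (-y) * r + C (-(y * e)) * X ^ m := by
      have h2 : ((∑ i, x i) ^ 2 - ∑ i, x i ^ 2) / 2 = e + y * ∑ i, z i := by
        have s1 : ∑ i, x i = ∑ i, z i + y := Fin.sum_univ_castSucc x
        have s2 : ∑ i, x i ^ 2 = ∑ i, z i ^ 2 + y ^ 2 := Fin.sum_univ_castSucc fun i => x i ^ 2
        rw [s1, s2, he]
        ring
      rw [h2, hr, Fin.prod_univ_castSucc, Fin.sum_univ_castSucc]
      simp only [C_add, C_mul, C_neg]
      ring
    rw [h1]
    exact add_mem (add_mem (X_mul_mem_degreeLT (ih z))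
      (C_mul_mem_degreeLT _ (degreeLT_mono m.le_succ (ih z))))
      (C_mul_mem_degreeLT _ (X_pow_mem_degreeLT m.lt_succ_self))

lemma altDet_prod (x : Fin (m + 1) → ℝ) (q : ℝ[X]) : altDet x (q * ∏ i, (X - C (x i))) = 0 := by
  refine altDet_eq_zero fun i => ?_
  rw [eval_mul, eval_prod, Finset.prod_eq_zero (Finset.mem_univ i) (by simp), mul_zero]

lemma altDet_sub (x : Fin (m + 1) → ℝ) (p q : ℝ[X]) :
    altDet x (p - q) = altDet x p - altDet x q := by
  have := altDet_add x (p - q) q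
  rw [sub_add_cancel] at this
  linarith

/-- The polynomial `∏ (X - x_i)` vanishes at all nodes, so modulo degree below `m` the power `X ^ (m
+ 1)` may be replaced by `e₁ * X ^ m`. The next power is treated in the same way after
multiplication by `X`, which yields `h₂ = e₁ * h₁ - e₂`. -/
lemma altDet_X_pow_succ (x : Fin (m + 1) → ℝ) :
    altDet x (X ^ (m + 1)) = (∑ i, x i) * (Matrix.vandermonde x).det := by
  have h1 := altDet_of_mem_degreeLT x (prod_X_sub_C_mem_degreeLT x)
  have h2 := altDet_prod x 1
  rw [one_mul] at h2
  rw [altDet_sub, altDet_sub, altDet_C_mul, altDet_X_pow, h2] at h1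
  linarith

lemma altDet_X_pow_add_two (x : Fin (m + 1) → ℝ) : altDet x (X ^ (m + 2)) =
    ((∑ i, x i) ^ 2 + ∑ i, x i ^ 2) / 2 * (Matrix.vandermonde x).det := by
  have h1 := altDet_of_mem_degreeLT x (X_mul_prod_X_sub_C_mem_degreeLT x)
  rw [altDet_sub, altDet_add, altDet_sub, altDet_C_mul, altDet_C_mul, altDet_X_pow,
    altDet_X_pow_succ, altDet_prod] at h1
  linarith

lemma exists_sub_C_mul_X_pow_mem_degreeLT {r : ℝ[X]} {k : ℕ} (hr : r ∈ degreeLT ℝ (k + 1)) :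
    ∃ c : ℝ, r - C c * X ^ k ∈ degreeLT ℝ k := by
  refine ⟨r.coeff k, ?_⟩
  rw [mem_degreeLT] at hr ⊢
  rw [degree_lt_iff_coeff_zero] at hr ⊢
  intro j hj
  rcases hj.eq_or_lt with rfl | hj
  · simp
  · rw [coeff_sub, hr j hj, coeff_C_mul, coeff_X_pow, if_neg hj.ne', mul_zero, sub_zero]

variable {u u' v v' : ℂ}

lemma altDet_polyGen_X_pow (x : Fin (m + 1) → ℝ) : altDet x (polyGen u u' v v' (X ^ m)) =
    eigen u u' v v' m * (Matrix.vandermonde x).det := by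
  have h1 := altDet_of_mem_degreeLT x
    (polyGen_X_pow (u := u) (u' := u') (v := v) (v' := v') m)
  rw [altDet_sub, altDet_C_mul, altDet_X_pow] at h1
  linarith

lemma exists_altDet_polyGen_X_pow_add_two (u u' v v' : ℂ) (m : ℕ) :
    ∃ a b : ℝ, ∀ x : Fin (m + 1) → ℝ, altDet x (polyGen u u' v v' (X ^ (m + 2))) =
      (eigen u u' v v' (m + 2) * (((∑ i, x i) ^ 2 + ∑ i, x i ^ 2) / 2) + a * ∑ i, x i + b) *
        (Matrix.vandermonde x).det := by
  obtain ⟨a, ha⟩ := exists_sub_C_mul_X_pow_mem_degreeLT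
    (polyGen_X_pow (u := u) (u' := u') (v := v) (v' := v') (m + 2))
  obtain ⟨b, hb⟩ := exists_sub_C_mul_X_pow_mem_degreeLT ha
  refine ⟨a, b, fun x => ?_⟩
  have h1 := altDet_of_mem_degreeLT x hb
  rw [altDet_sub, altDet_sub, altDet_sub, altDet_C_mul, altDet_C_mul, altDet_C_mul, altDet_X_pow,
    altDet_X_pow_succ, altDet_X_pow_add_two] at h1
  linarith

end SymmetricFunctions

/-! ### The rates on signatures and their Lyapunov function -/

section LyapunovFunction

variable {N m : ℕ} {u u' v v' : ℂ}

lemma gen_const_mul (c : ℝ) (F : (Fin N → ℤ) → ℝ) (l : Fin N → ℤ) :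
    gen u u' v v' (fun l => c * F l) l = c * gen u u' v v' F l := by
  simp only [gen, Finset.mul_sum]
  exact Finset.sum_congr rfl fun i _ => Finset.sum_congr rfl fun y _ => by ring

lemma dimScale_mul_altDet_eq_zero (p : Polynomial ℝ) {l : Fin (m + 1) → ℤ}
    (hl : ¬ Function.Injective l) : dimScale (m + 1) * altDet (fun i => (l i : ℝ)) p = 0 := by
  rw [altDet_of_not_injective, mul_zero]
  exact fun h => hl fun i j hij => h (by simp [hij])

/-- In the Doob transform, `d_N` cancels the eigenvalues of the first `m` columns and leaves only
that of the last one, `eigen m`. -/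
lemma sum_nbrs_rateN_altDet (p : Polynomial ℝ) {g : Signature (m + 1) → ℝ}
    (hg : ∀ nu, altDet (fun i => (coord nu i : ℝ)) p = vdm (coord nu) * g nu)
    (lam : Signature (m + 1)) :
    ∑ nu ∈ nbrs lam, rateN u u' v v' (m + 1) lam nu * g nu =
      (vdm (coord lam))⁻¹ * altDet (fun i => (coord lam i : ℝ)) (polyGen u u' v v' p) -
        eigen u u' v v' m * g lam := by
  have h1 := dimScale_ne_zero lam
  have h2 := vdm_coord_ne_zero lam
  rw [sum_nbrs_rateN (by omega) _ (fun l hl => dimScale_mul_altDet_eq_zero p hl)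
    (fun nu => by rw [hg, dim_eq, mul_assoc]), gen_const_mul, gen_altDet, hg, dim_eq,
    ← sum_eigen (m + 1), Finset.sum_range_succ]
  field_simp
  ring

/-- The case `p = X ^ m`: the alternant is the Vandermonde determinant, and its last column
contributes exactly `eigen m`. -/
lemma sum_nbrs_rateN_one (lam : Signature (m + 1)) :
    ∑ nu ∈ nbrs lam, rateN u u' v v' (m + 1) lam nu = 0 := by
  have h := sum_nbrs_rateN_altDet (u := u) (u' := u') (v := v) (v' := v') (Polynomial.X ^ m)
    (g := fun _ => 1) (fun nu => by rw [altDet_X_pow, vdm, mul_one]) lam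
  simp only [mul_one] at h
  rw [h, altDet_polyGen_X_pow]
  have h2 := vdm_coord_ne_zero lam
  change (vdm (coord lam))⁻¹ * (_ * vdm (coord lam)) - _ = 0
  field_simp
  ring

lemma Admissible.isRateMatrix_rateN (h : Admissible u u' v v') (hN : 1 ≤ N) :
    IsRateMatrix (rateN u u' v v' N) := by
  obtain ⟨m, rfl⟩ : ∃ m, N = m + 1 := ⟨N - 1, by omega⟩
  exact isRateMatrix_of_sum_eq_zero (fun _ _ => h.rateN_nonneg)
    (fun _ _ => rateN_eq_zero_of_notMem_nbrs hN) sum_nbrs_rateN_one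

/-- One plus the complete homogeneous symmetric polynomial of degree `2` in the coordinates. -/
def lyap (lam : Signature N) : ℝ :=
  1 + ((∑ i, (coord lam i : ℝ)) ^ 2 + ∑ i, (coord lam i : ℝ) ^ 2) / 2

lemma one_le_lyap (lam : Signature N) : 1 ≤ lyap lam := by
  have h1 : 0 ≤ ∑ i, (coord lam i : ℝ) ^ 2 := Finset.sum_nonneg fun _ _ => sq_nonneg _
  have h2 := sq_nonneg (∑ i, (coord lam i : ℝ))
  simp only [lyap]
  linarith

lemma sum_sq_le_lyap (lam : Signature N) :
    (∑ i, (coord lam i : ℝ)) ^ 2 + ∑ i, (coord lam i : ℝ) ^ 2 + 2 = 2 * lyap lam := by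
  simp only [lyap]
  ring

lemma sum_sq_nonneg (lam : Signature N) : 0 ≤ ∑ i, (coord lam i : ℝ) ^ 2 :=
  Finset.sum_nonneg fun _ _ => sq_nonneg _

lemma sq_coord_le (lam : Signature N) (i : Fin N) :
    (coord lam i : ℝ) ^ 2 ≤ ∑ i, (coord lam i : ℝ) ^ 2 :=
  Finset.single_le_sum (f := fun i => (coord lam i : ℝ) ^ 2) (fun _ _ => sq_nonneg _)
    (Finset.mem_univ i)

lemma finite_lyap_le (K : ℝ) : {lam : Signature N | lyap lam ≤ K}.Finite := by
  have hfin : (Icc (fun _ : Fin N => -⌈2 * K⌉) fun _ => ⌈2 * K⌉).Finite := finite_Icc _ _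
  refine (hfin.preimage coord_injective.injOn).subset fun lam hlam => ?_
  have h1 : ∀ i, |coord lam i| ≤ ⌈2 * K⌉ := fun i => by
    have h2 : |(coord lam i : ℝ)| ≤ 2 * K := by
      have hl : lyap lam ≤ K := hlam
      have := sum_sq_le_lyap lam
      have := sq_coord_le lam i
      have := sq_nonneg (∑ i, (coord lam i : ℝ))
      rw [abs_le]
      constructor <;> nlinarith [sq_nonneg ((coord lam i : ℝ) - 1), sq_nonneg ((coord lam i : ℝ) + 1)]
    have h3 := h2.trans (Int.le_ceil _)
    exact_mod_cast h3
  exact ⟨fun i => (abs_le.1 (h1 i)).1, fun i => (abs_le.1 (h1 i)).2⟩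

lemma tendsto_inv_lyap : Tendsto (fun lam : Signature N => (lyap lam)⁻¹) cofinite (𝓝 0) := by
  refine tendsto_inv_atTop_zero.comp (tendsto_atTop.2 fun K => ?_)
  refine (finite_lyap_le K).subset fun lam hlam => ?_
  exact (not_le.1 (show ¬K ≤ lyap lam from hlam)).le

/-- The polynomial `X ^ m + X ^ (m + 2)` yields the quotient `1 + h₂ = lyap`. The upper bound is the
Lyapunov condition; the lower bound is needed for `1 / lyap`. -/
lemma exists_abs_sum_rateN_lyap_le (u u' v v' : ℂ) (hN : 1 ≤ N) : ∃ C, 0 ≤ C ∧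
    ∀ lam : Signature N, |∑ nu ∈ nbrs lam, rateN u u' v v' N lam nu * lyap nu| ≤ C * lyap lam := by
  obtain ⟨m, rfl⟩ : ∃ m, N = m + 1 := ⟨N - 1, by omega⟩
  obtain ⟨a, b, hab⟩ := exists_altDet_polyGen_X_pow_add_two u u' v v' m
  set e := eigen u u' v v' (m + 2) - eigen u u' v v' m with he
  refine ⟨|e| + 2 * |a| + |b|, by positivity, fun lam => ?_⟩
  have h1 := sum_nbrs_rateN_altDet (u := u) (u' := u') (v := v) (v' := v')
    (Polynomial.X ^ m + Polynomial.X ^ (m + 2)) (g := lyap) (fun nu => by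
      rw [altDet_add, altDet_X_pow, altDet_X_pow_add_two, vdm, lyap]
      ring) lam
  rw [polyGen_add, altDet_add, altDet_polyGen_X_pow, hab] at h1
  set P := ∑ i, (coord lam i : ℝ) with hP
  have h2 := sum_sq_le_lyap lam
  have h3 : (vdm (coord lam))⁻¹ * (Matrix.vandermonde fun i => (coord lam i : ℝ)).det = 1 :=
    inv_mul_cancel₀ (vdm_coord_ne_zero lam)
  have h4 : ∑ nu ∈ nbrs lam, rateN u u' v v' (m + 1) lam nu * lyap nu =
      e * (lyap lam - 1) + a * P + b := by
    have h5 : (P ^ 2 + ∑ i, (coord lam i : ℝ) ^ 2) / 2 = lyap lam - 1 := by linarith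
    rw [h1, h5, he]
    linear_combination (eigen u u' v v' m + (eigen u u' v v' (m + 2) * (lyap lam - 1) + a * P + b)) * h3
  rw [h4]
  have hl := one_le_lyap lam
  have h5 : |P| ≤ 2 * lyap lam := by
    have := sum_sq_nonneg lam
    rw [abs_le]
    constructor <;> nlinarith [sq_nonneg (P - 1), sq_nonneg (P + 1)]
  calc |e * (lyap lam - 1) + a * P + b| ≤ |e * (lyap lam - 1)| + |a * P| + |b| := abs_add_three _ _ _
    _ = |e| * (lyap lam - 1) + |a| * |P| + |b| := by
        rw [abs_mul, abs_mul, abs_of_nonneg (sub_nonneg.2 hl)]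
    _ ≤ |e| * lyap lam + |a| * (2 * lyap lam) + |b| * lyap lam := by
        gcongr
        · linarith
        · exact le_mul_of_one_le_right (abs_nonneg b) hl
    _ = _ := by ring

lemma exists_birthRate_add_deathRate_le (u u' v v' : ℂ) : ∃ C, 0 ≤ C ∧
    ∀ x : ℤ, birthRate u u' x + deathRate v v' x ≤ C * (1 + (x : ℝ) ^ 2) := by
  set a := (v + v').re - (u + u').re with ha
  set b := (u * u').re + (v * v').re with hb
  refine ⟨2 + |a| + |b|, by positivity, fun x => ?_⟩
  rw [birthRate_eq, deathRate_eq]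
  have h1 : a * x ≤ |a| * (1 + (x : ℝ) ^ 2) := by
    calc a * x ≤ |a| * |(x : ℝ)| := by
          rw [← abs_mul]
          exact le_abs_self _
      _ ≤ _ := by
          gcongr
          rw [abs_le]
          constructor <;> nlinarith [sq_nonneg ((x : ℝ) - 1), sq_nonneg ((x : ℝ) + 1)]
  have h2 : b ≤ |b| * (1 + (x : ℝ) ^ 2) :=
    (le_abs_self b).trans (le_mul_of_one_le_right (abs_nonneg b) (by nlinarith [sq_nonneg (x : ℝ)]))
  nlinarith

lemma exists_neg_rateN_self_le (u u' v v' : ℂ) (N : ℕ) : ∃ C, 0 ≤ C ∧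
    ∀ lam : Signature N, -rateN u u' v v' N lam lam ≤ C * lyap lam := by
  obtain ⟨C, hC, hle⟩ := exists_birthRate_add_deathRate_le u u' v v'
  refine ⟨C * (N + 2) + |dConst u u' v v' N|, by positivity, fun lam => ?_⟩
  rw [rateN_self, neg_sub, Finset.sum_congr rfl fun i _ =>
    (neg_add' (birthRate u u' (coord lam i)) (deathRate v v' (coord lam i))).symm,
    Finset.sum_neg_distrib, sub_neg_eq_add]
  have h1 : ∑ i, (birthRate u u' (coord lam i) + deathRate v v' (coord lam i)) ≤
      C * (N + ∑ i, (coord lam i : ℝ) ^ 2) := by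
    calc _ ≤ ∑ i, C * (1 + (coord lam i : ℝ) ^ 2) := Finset.sum_le_sum fun i _ => hle _
      _ = _ := by
        rw [← Finset.mul_sum, Finset.sum_add_distrib]
        simp
  have hl := one_le_lyap lam
  have h2 : (N : ℝ) + ∑ i, (coord lam i : ℝ) ^ 2 ≤ (N + 2) * lyap lam := by
    have := sum_sq_le_lyap lam
    have := sq_nonneg (∑ i, (coord lam i : ℝ))
    have : (N : ℝ) ≤ N * lyap lam := le_mul_of_one_le_right (Nat.cast_nonneg N) hl
    linarith
  have h3 := mul_le_mul_of_nonneg_left h2 hC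
  have h4 : dConst u u' v v' N ≤ |dConst u u' v v' N| * lyap lam :=
    (le_abs_self _).trans (le_mul_of_one_le_right (abs_nonneg _) hl)
  linarith

lemma sq_lyap_sub_le {lam nu : Signature N} (h : nu ∈ nbrs lam) :
    (lyap nu - lyap lam) ^ 2 ≤ 8 * lyap nu := by
  obtain ⟨i, y, hy, hnu⟩ := mem_nbrs.1 h
  have hi : coord nu i = y := by rw [← hnu, Function.update_self]
  have hsum : ∀ f : ℤ → ℝ, ∑ j, f (coord nu j) = ∑ j, f (coord lam j) + (f y - f (coord lam i)) := by
    intro f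
    rw [← Finset.add_sum_erase _ _ (Finset.mem_univ i),
      ← Finset.add_sum_erase _ (fun j => f (coord lam j)) (Finset.mem_univ i), hi]
    rw [Finset.sum_congr rfl fun j hj => by
      rw [← hnu, Function.update_of_ne (Finset.ne_of_mem_erase hj)]]
    ring
  have h1 := hsum fun x => (x : ℝ)
  have h2 := hsum fun x => (x : ℝ) ^ 2
  set η : ℝ := (y : ℝ) - coord lam i with hη
  have hη2 : η = -1 ∨ η = 0 ∨ η = 1 := by
    rcases mem_near.1 hy with h | h | h <;> rw [hη, h] <;> push_cast <;> simp
  set P := ∑ j, (coord nu j : ℝ) with hP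
  -- The increment is linear in the target coordinates while `lyap` is quadratic, so its square is
  -- bounded by a multiple of `lyap nu`.
  have h3 : lyap nu - lyap lam = η * (P + y) - η ^ 2 := by
    have h4 : (coord lam i : ℝ) = y - η := by rw [hη]; ring
    have h5 : ∑ j, (coord lam j : ℝ) = P - η := by linarith
    rw [lyap, lyap, h2, ← hP, h5, h4]
    ring
  have h4 := sum_sq_le_lyap nu
  have h5 := sq_coord_le nu i
  rw [hi] at h5
  rw [← hP] at h4
  rw [h3]
  rcases hη2 with h | h | h <;> rw [h] <;>
    nlinarith [sq_nonneg (P - y), sq_nonneg (P + y + 1), sq_nonneg (P + y - 1), one_le_lyap nu]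

end LyapunovFunction

/-! ### The determinant formula and the conclusion -/

section KarlinMcGregor

lemma det_eq_sum_prod_row {n : Type*} [Fintype n] [DecidableEq n] (M : Matrix n n ℝ) :
    M.det = ∑ σ : Equiv.Perm n, (Equiv.Perm.sign σ : ℝ) * ∏ i, M i (σ i) := by
  rw [← Matrix.det_transpose, Matrix.det_apply']
  rfl

lemma hasDerivAt_det {n : Type*} [Fintype n] [DecidableEq n] {A : ℝ → Matrix n n ℝ}
    {A' : Matrix n n ℝ} {t : ℝ} (h : ∀ i j, HasDerivAt (fun s => A s i j) (A' i j) t) :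
    HasDerivAt (fun s => (A s).det) (∑ i, ((A t).updateRow i (A' i)).det) t := by
  simp_rw [det_eq_sum_prod_row]
  rw [Finset.sum_comm]
  refine HasDerivAt.fun_sum fun σ _ => ?_
  rw [← Finset.mul_sum]
  refine HasDerivAt.const_mul _ ?_
  refine (HasDerivAt.fun_finsetProd fun i _ => h i (σ i)).congr_deriv ?_
  refine Finset.sum_congr rfl fun i _ => ?_
  rw [← Finset.mul_prod_erase _ _ (Finset.mem_univ i), Matrix.updateRow_self, smul_eq_mul, mul_comm]
  congr 1
  refine Finset.prod_congr rfl fun j hj => ?_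
  rw [Matrix.updateRow_ne (Finset.ne_of_mem_erase hj)]

variable {N : ℕ} {u u' v v' : ℂ}

/-- The determinant of the one-dimensional transition functions. -/
def kmDet (u u' v v' : ℂ) (t : ℝ) (l n : Fin N → ℤ) : ℝ :=
  (Matrix.of fun i j : Fin N => semigroup (rateOne u u' v v') t (l i) (n j)).det

lemma Admissible.continuousOn_kmDet (h : Admissible u u' v v') (l n : Fin N → ℤ) :
    ContinuousOn (fun t => kmDet u u' v v' t l n) (Ici 0) := by
  simp_rw [kmDet, det_eq_sum_prod_row]
  exact continuousOn_finsetSum _ fun σ _ => continuousOn_const.mul <|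
    continuousOn_finsetProd _ fun i _ => continuousOn_semigroup h.isRateMatrix_rateOne
      (fun _ _ => rateOne_eq_zero_of_notMem_near) self_mem_near _ _

/-- The product rule differentiates one row at a time, and each row satisfies the one-dimensional
backward equation. -/
lemma Admissible.hasDerivAt_kmDet (h : Admissible u u' v v') (l n : Fin N → ℤ) {t : ℝ}
    (ht : 0 < t) : HasDerivAt (fun t => kmDet u u' v v' t l n)
      (gen u u' v v' (fun l => kmDet u u' v v' t l n) l) t := by
  have h1 := gen_det (u := u) (u' := u') (v := v) (v' := v')
    (fun j x => semigroup (rateOne u u' v v') t x (n j)) l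
  unfold kmDet
  rw [h1]
  exact hasDerivAt_det (A := fun t => Matrix.of fun i j : Fin N =>
      semigroup (rateOne u u' v v') t (l i) (n j))
    (A' := Matrix.of fun i j => ∑ y ∈ near (l i), rateOne u u' v v' (l i) y *
      semigroup (rateOne u u' v v') t y (n j))
    fun i j => hasDerivAt_semigroup h.isRateMatrix_rateOne
      (fun _ _ => rateOne_eq_zero_of_notMem_near) self_mem_near ht _ _

lemma kmDet_eq_zero_of_not_injective (t : ℝ) {l : Fin N → ℤ} (n : Fin N → ℤ)
    (hl : ¬ Function.Injective l) : kmDet u u' v v' t l n = 0 := by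
  obtain ⟨i, j, hij, hne⟩ : ∃ i j, l i = l j ∧ i ≠ j := by
    simpa [Function.Injective] using hl
  refine Matrix.det_zero_of_row_eq hne ?_
  ext k
  simp [hij]

lemma Admissible.abs_kmDet_le (h : Admissible u u' v v') {t : ℝ} (ht : 0 ≤ t)
    (l n : Fin N → ℤ) : |kmDet u u' v v' t l n| ≤ (N ! : ℝ) := by
  have h1 := Matrix.det_le (abv := AbsoluteValue.abs) (x := (1 : ℝ))
    (A := Matrix.of fun i j : Fin N => semigroup (rateOne u u' v v') t (l i) (n j)) fun i j => by
      rw [Matrix.of_apply, AbsoluteValue.abs_apply, abs_of_nonneg (semigroup_nonneg _ _ _)]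
      exact semigroup_le_one h.isRateMatrix_rateOne
        (fun _ _ => rateOne_eq_zero_of_notMem_near) self_mem_near ht _ _
  simpa [kmDet] using h1

-- A strictly decreasing tuple is determined by its range. If the ranges differ, some `coord lam i`
-- is missing from that of `nu`, and row `i` vanishes.
open Classical in
lemma kmDet_zero (lam nu : Signature N) :
    kmDet u u' v v' 0 (coord lam) (coord nu) = if lam = nu then 1 else 0 := by
  have hent : ∀ i j, semigroup (rateOne u u' v v') 0 (coord lam i) (coord nu j) =
      if coord lam i = coord nu j then 1 else 0 := fun i j => by
    rw [semigroup_zero]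
    congr
  unfold kmDet
  simp_rw [hent]
  split_ifs with heq
  · subst heq
    rw [← Matrix.det_one (n := Fin N)]
    congr 1
    ext i j
    simp [Matrix.one_apply, (coord_strictAnti lam).injective.eq_iff]
  · by_cases hsub : range (coord lam) ⊆ range (coord nu)
    · refine absurd ?_ heq
      have hinj := (coord_strictAnti lam).injective
      have hrange : range (coord lam) = range (coord nu) := by
        refine Set.eq_of_subset_of_ncard_le hsub ?_ (finite_range _)
        rw [← image_univ, ← image_univ, ncard_image_of_injective _ hinj,
          ncard_image_of_injective _ (coord_strictAnti nu).injective]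
      apply coord_injective
      have h1 := StrictMono.range_inj (f := OrderDual.toDual ∘ coord lam)
        (g := OrderDual.toDual ∘ coord nu) (coord_strictAnti lam).dual_right
        (coord_strictAnti nu).dual_right
      exact h1.1 hrange
    · obtain ⟨_, ⟨i, rfl⟩, hi⟩ := not_subset.1 hsub
      refine Matrix.det_eq_zero_of_row_eq_zero i fun j => ?_
      rw [Matrix.of_apply, if_neg]
      exact fun h => hi ⟨j, h.symm⟩

theorem exists_isLyapunov_rateN (u u' v v' : ℂ) (hN : 1 ≤ N) :
    ∃ C, IsLyapunov (rateN u u' v v' N) nbrs lyap C := by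
  obtain ⟨C, hC, hle⟩ := exists_abs_sum_rateN_lyap_le u u' v v' hN
  exact ⟨C, fun lam => zero_le_one.trans (one_le_lyap lam), finite_lyap_le, hC,
    fun lam => (le_abs_self _).trans (hle lam)⟩

theorem Admissible.isFellerSemigroup (h : Admissible u u' v v') (hN : 1 ≤ N) :
    IsFellerSemigroup (semigroup (rateN u u' v v' N)) := by
  have hQ := h.isRateMatrix_rateN hN
  have hS : ∀ lam, ∀ nu ∉ nbrs lam, rateN u u' v v' N lam nu = 0 :=
    fun _ _ => rateN_eq_zero_of_notMem_nbrs hN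
  obtain ⟨C, hf⟩ := exists_isLyapunov_rateN u u' v v' hN
  obtain ⟨C₁, hC₁, h₁⟩ := exists_abs_sum_rateN_lyap_le u u' v v' hN
  obtain ⟨C₂, hC₂, h₂⟩ := exists_neg_rateN_self_le u u' v v' N
  have hpos : ∀ lam : Signature N, 0 < lyap lam := fun lam =>
    zero_lt_one.trans_le (one_le_lyap lam)
  have hinv := sum_mul_inv_le hQ hS (self_mem_nbrs hN) hpos (C₃ := 8) (by norm_num)
    (fun lam => (abs_le.1 (h₁ lam)).1) h₂ fun lam nu hne => sq_lyap_sub_le <| by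
      by_contra hc
      exact hne (hS _ _ hc)
  exact isFellerSemigroup_of_le
    (isMarkovSemigroup_semigroup (isRegularRateMatrix_of_isLyapunov hQ hS (self_mem_nbrs hN) hf))
    (continuousOn_semigroup hQ hS (self_mem_nbrs hN)) (fun lam => inv_pos.2 (hpos lam))
    tendsto_inv_lyap (C := C₁ + C₂ * 8) (by positivity)
    fun t ht => semigroup_le_of_supersolution hQ hS (self_mem_nbrs hN)
      (fun lam => inv_pos.2 (hpos lam)) (by positivity) hinv ht

theorem Admissible.semigroup_rateN_eq (h : Admissible u u' v v') (hN : 1 ≤ N) {T : ℝ}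
    (hT : 0 ≤ T) (lam nu : Signature N) : semigroup (rateN u u' v v' N) T lam nu =
      Real.exp (-dConst u u' v v' N * T) * (dim nu / dim lam) *
        kmDet u u' v v' T (coord lam) (coord nu) := by
  classical
  set d := dConst u u' v v' N with hd
  obtain ⟨C, hf⟩ := exists_isLyapunov_rateN u u' v v' hN
  set w : ℝ → Signature N → ℝ := fun t lam => Real.exp (-d * t) * (dim nu / dim lam) *
    kmDet u u' v v' t (coord lam) (coord nu) with hw
  refine (eq_semigroup_of_backward (h.isRateMatrix_rateN hN)
    (fun _ _ => rateN_eq_zero_of_notMem_nbrs hN) (self_mem_nbrs hN) hf nu (w := w)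
    -- The three factors bound the exponential on `[0, T]`, the quotient of dimensions through
    -- `inv_le_dim`, and a determinant with entries in `[0, 1]`.
    (B := Real.exp (|d| * T) * (dim nu / (∏ i ∈ Finset.range N, (i ! : ℝ))⁻¹) * (N ! : ℝ))
    (fun lam => ?_) (fun lam t ht => ?_) hT (fun t ht lam => ?_) (fun lam => ?_) lam).symm
  · exact ContinuousOn.mul (by fun_prop) (h.continuousOn_kmDet _ _)
  · have hexp : HasDerivAt (fun t => Real.exp (-d * t)) (Real.exp (-d * t) * -d) t := by
      simpa using ((hasDerivAt_id t).const_mul (-d)).exp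
    have h1 := (hexp.mul_const (dim nu / dim lam)).mul
      (h.hasDerivAt_kmDet (coord lam) (coord nu) ht)
    -- The factor `1 / dim lam` of `w` is the Doob transform, so `dim mu * w t mu` is a multiple of
    -- `kmDet`, which vanishes at collisions. The term `-d` from the exponential matches the
    -- subtracted `dConst`.
    have h2 := sum_nbrs_rateN (u := u) (u' := u') (v := v) (v' := v') hN
      (fun l => Real.exp (-d * t) * dim nu * kmDet u u' v v' t l (coord nu))
      (fun l hl => by rw [kmDet_eq_zero_of_not_injective t _ hl, mul_zero]) (g := w t)
      (fun mu => by
        have := (dim_pos mu).ne'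
        simp only [hw]
        field_simp) lam
    rw [gen_const_mul] at h2
    refine h1.congr_deriv ?_
    rw [h2, ← hd]
    simp only [hw]
    have := (dim_pos lam).ne'
    field_simp
    ring
  · have hdl := dim_pos lam
    have hdn := dim_pos nu
    have hfac : (0 : ℝ) < (∏ i ∈ Finset.range N, (i ! : ℝ))⁻¹ :=
      inv_pos.2 (Finset.prod_pos fun i _ => by exact_mod_cast Nat.factorial_pos i)
    simp only [hw]
    rw [abs_mul, abs_mul, abs_of_pos (Real.exp_pos _), abs_of_pos (div_pos hdn hdl)]
    gcongr
    · exact ht.1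
    · exact neg_le_abs d
    · exact ht.2
    · exact inv_le_dim lam
    · exact h.abs_kmDet_le ht.1 _ _
  · simp only [hw, kmDet_zero, mul_zero, Real.exp_zero, one_mul]
    split_ifs with heq
    · rw [heq, div_self (dim_pos nu).ne', one_mul]
    · rw [mul_zero]

end KarlinMcGregor

end GTChain

end

theorem theorem3p7 (u u' v v' : ℂ) (h : GTChain.Admissible u u' v v') (N : ℕ) (hN : 1 ≤ N) :
    GTChain.IsRegularRateMatrix (GTChain.rateN u u' v v' N) ∧
    (∀ t : ℝ, 0 ≤ t → ∀ lam nu : GTChain.Signature N,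
      GTChain.semigroup (GTChain.rateN u u' v v' N) t lam nu =
        Real.exp (-GTChain.dConst u u' v v' N * t) * (GTChain.dim nu / GTChain.dim lam) *
          (Matrix.of fun i j : Fin N =>
            GTChain.semigroup (GTChain.rateOne u u' v v') t
              (GTChain.coord lam i) (GTChain.coord nu j)).det) ∧
    GTChain.IsFellerSemigroup (GTChain.semigroup (GTChain.rateN u u' v v' N)) := by
  obtain ⟨C, hC⟩ := GTChain.exists_isLyapunov_rateN u u' v v' hN
  exact ⟨GTChain.isRegularRateMatrix_of_isLyapunov (h.isRateMatrix_rateN hN)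
      (fun _ _ => GTChain.rateN_eq_zero_of_notMem_nbrs hN) (GTChain.self_mem_nbrs hN) hC,
    fun t ht lam nu => h.semigroup_rateN_eq hN ht lam nu, h.isFellerSemigroup hN⟩
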